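/- Let $\gamma$ be a fermionic one-particle density matrix on $L^2(\mathbb{R}^3)=L^2(\mathbb{R}^3;\mathbb{C})$, i.e. $\gamma$ is trace class, $0\le\gamma\le 1$, and $\Delta\gamma$ is trace class. Let $\chi:\mathbb{R}^3\to\mathbb{R}$ be a smooth function with $0\le\chi(x)\le 1$ for all $x$; we also write $\chi$ for the operator of multiplication by $\chi$. Let $p\in[1/2,1]$. For a Hilbert–Schmidt operator $A$ on $L^2(\mathbb{R}^3)$ with integral kernel $A(x,y)\in L^2(\mathbb{R}^3\times\mathbb{R}^3)$ put $$X(A)=\frac12\iint\frac{|A(x,y)|^2}{|x-y|}\,dx\,dy\in[0,\infty],$$ for a positive bounded operator $T$ let $\mathrm{tr}(-\Delta T)=\|\nabla T^{1/2}\|_{\mathrm{HS}}^2\in[0,\infty]$, and let $\rho_\gamma(x)=\sum_i\lambda_i|u_i(x)|^2$, where $(u_i)$ is an orthonormal basis of eigenvectors of $\gamma$ with eigenvalues $\lambda_i$. Then $\chi\gamma^p\chi$, $(\chi\gamma\chi)^p$ and $\chi\gamma^p$ have square integrable integral kernels, and, as inequalities in $[0,\infty]$ (with $0\cdot\infty=0$),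 $$X(\chi\gamma^p\chi)\le X\big((\chi\gamma\chi)^p\big)$$ and $$X(\chi\gamma^p)\le\big(\mathrm{tr}(-\Delta\,\chi\gamma\chi)\big)^{1/2}\Big(\int_{\mathbb{R}^3}\chi^2\rho_\gamma\,dx\Big)^{1/2}.$$ -/

import Mathlib

open MeasureTheory
open scoped ENNReal ContDiff InnerProductSpace FourierTransform SchwartzMap Laplacian

namespace DensityMatrix

noncomputable section

/-- The space `ℝ³` with its Euclidean norm. -/
abbrev R3 : Type := EuclideanSpace ℝ (Fin 3)

/-- The complex Hilbert space `L²(ℝ³)`. -/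
abbrev L2 : Type := Lp ℂ 2 (volume : Measure R3)

/-- Bounded operators on `L²(ℝ³)`, with the Loewner order: `A ≤ B` iff `B - A` is positive. -/
abbrev Op : Type := L2 →L[ℂ] L2

/-- The power `A ^ p` of a positive operator, by the continuous functional calculus. -/
def power {H : Type*} [NormedAddCommGroup H] [InnerProductSpace ℂ H] [CompleteSpace H]
    (A : H →L[ℂ] H) (p : ℝ) : H →L[ℂ] H := A ^ p

/-- The positive square root of a positive operator. -/
def sqrtOp {H : Type*} [NormedAddCommGroup H] [InnerProductSpace ℂ H] [CompleteSpace H]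
    (A : H →L[ℂ] H) : H →L[ℂ] H := CFC.sqrt A

/-- The absolute value `|A| = (A* A)^(1/2)` of an operator. -/
def absOp {H : Type*} [NormedAddCommGroup H] [InnerProductSpace ℂ H] [CompleteSpace H]
    (A : H →L[ℂ] H) : H →L[ℂ] H := CFC.abs A

/-- The trace, in `[0, ∞]`, of a nonnegative quadratic form `q` on a Hilbert space: the supremum
of `∑ q(f)` over all finite orthonormal systems. -/
def formTrace {H : Type*} [NormedAddCommGroup H] [InnerProductSpace ℂ H] (q : H → ℝ≥0∞) : ℝ≥0∞ :=
  ⨆ (s : Finset H) (_ : Orthonormal ℂ (fun f : s => (f : H))), ∑ f ∈ s, q f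

/-- `A` is a trace class operator: `tr |A| < ∞`. -/
def IsTraceClass {H : Type*} [NormedAddCommGroup H] [InnerProductSpace ℂ H] [CompleteSpace H]
    (A : H →L[ℂ] H) : Prop :=
  formTrace (fun f : H => ENNReal.ofReal (⟪f, absOp A f⟫_ℂ).re) < ⊤

/-- The fermionic one-particle density matrices: `γ` is trace class, `0 ≤ γ ≤ 1`, and `Δ γ` is
trace class, where `Δ` is the distributional Laplacian. -/
structure IsDensityMatrix (γ : Op) : Prop where
  traceClass : IsTraceClass γ
  nonneg : 0 ≤ γ
  le_one : γ ≤ 1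
  laplacian_traceClass : ∃ D : Op,
    (∀ f : L2, ((D f : L2) : 𝓢'(R3, ℂ)) = Δ ((γ f : L2) : 𝓢'(R3, ℂ))) ∧ IsTraceClass D

open Classical in
/-- The operator of multiplication by a (bounded measurable) function `χ` on `L²(ℝ³)`. -/
def mulOp (χ : R3 → ℝ) : Op :=
  if h : MemLp (fun x => (χ x : ℂ)) ⊤ (volume : Measure R3) then
    (ContinuousLinearMap.mul ℂ ℂ).holderL volume ⊤ 2 2 h.toLp
  else 0

theorem mulOp_apply_ae {χ : R3 → ℝ} (hχ : Continuous χ) (h0 : ∀ x, 0 ≤ χ x)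
    (h1 : ∀ x, χ x ≤ 1) (f : L2) :
    mulOp χ f =ᵐ[volume] fun x => (χ x : ℂ) * f x := by
  have h : MemLp (fun x => (χ x : ℂ)) ⊤ (volume : Measure R3) := by
    refine memLp_top_of_bound (Complex.continuous_ofReal.comp hχ).aestronglyMeasurable 1 ?_
    refine Filter.Eventually.of_forall fun x => ?_
    simpa [abs_of_nonneg (h0 x)] using h1 x
  rw [mulOp, dif_pos h]
  filter_upwards [(ContinuousLinearMap.mul ℂ ℂ).coeFn_holder (r := 2) h.toLp f,
    h.coeFn_toLp] with x hx hx'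
  rw [ContinuousLinearMap.holderL_apply_apply, hx, hx']
  rfl

/-- `k` is a square integrable integral kernel of `A`: `k ∈ L²(ℝ³ × ℝ³)` and
`(A f)(x) = ∫ k(x, y) f(y) dy`. Such a `k` is unique almost everywhere. -/
def IsKernel (A : Op) (k : R3 × R3 → ℂ) : Prop :=
  MemLp k 2 (volume : Measure (R3 × R3)) ∧
    ∀ f : L2, A f =ᵐ[volume] fun x => ∫ y, k (x, y) * f y

/-- `A` is an integral operator with a square integrable kernel. -/
def HasKernel (A : Op) : Prop := ∃ k, IsKernel A k

open Classical in
/-- The square integrable integral kernel `A(x, y)` of an operator that has one. -/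
def kernel (A : Op) : R3 × R3 → ℂ :=
  if h : HasKernel A then h.choose else 0

/-- The exchange term `X(A) = (1/2) ∬ |A(x, y)|² / |x - y| dx dy`, with values in `[0, ∞]`. -/
def exchange (A : Op) : ℝ≥0∞ :=
  2⁻¹ * ∫⁻ z : R3 × R3, ‖kernel A z‖ₑ ^ 2 / ‖z.1 - z.2‖ₑ

/-- The quadratic form of `-Δ`, with values in `[0, ∞]`:
`∫ |∇ f|² = ∫ (2π|ξ|)² |(𝓕 f)(ξ)|² dξ`, for `(𝓕 f)(ξ) = ∫ exp(-2πi x·ξ) f(x) dx`.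
It is finite exactly for `f` in the Sobolev space `H¹`. -/
def kineticForm (f : L2) : ℝ≥0∞ :=
  ∫⁻ ξ : R3, ENNReal.ofReal ((2 * Real.pi * ‖ξ‖) ^ 2) * ‖(𝓕 f : L2) ξ‖ₑ ^ 2

/-- The kinetic energy `tr(-Δ T)` of a positive operator `T`, with values in `[0, ∞]`: the squared
Hilbert-Schmidt norm `‖∇ T^(1/2)‖²`, that is, the trace of the form `f ↦ ‖∇ T^(1/2) f‖²`. -/
def kineticTrace (T : Op) : ℝ≥0∞ :=
  formTrace (fun f => kineticForm (sqrtOp T f))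

/-- A spectral decomposition of `γ`: an orthonormal basis `u` of eigenvectors of `γ` with
eigenvalues `l`. -/
def IsSpectralDecomposition (γ : Op) (u : HilbertBasis ℕ ℂ L2) (l : ℕ → ℝ) : Prop :=
  ∀ i, γ (u i) = (l i : ℂ) • u i

open Classical in
/-- The density `ρ_γ(x) = γ(x, x)`, defined through the spectral decomposition of `γ` as
`ρ_γ(x) = ∑ l_i |u_i(x)|²`. It does not depend on the decomposition, up to null sets. -/
def density (γ : Op) (x : R3) : ℝ≥0∞ :=
  if h : ∃ u : HilbertBasis ℕ ℂ L2, ∃ l : ℕ → ℝ, IsSpectralDecomposition γ u l then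
    ∑' i, ENNReal.ofReal (h.choose_spec.choose i) * ‖(h.choose i : L2) x‖ₑ ^ 2
  else 0

end

end DensityMatrix

open DensityMatrix

/-! The proof works with the squared Hilbert–Schmidt norm `hsNormSq b A = ∑ ‖A bᵢ‖²` in `[0, ∞]`. It
does not depend on the basis, is unchanged under adjoints, and `A A* ≤ B B*` implies
`‖M A‖ ≤ ‖M B‖` for every `M` (`hsNormSq_mul_le`). An operator of finite Hilbert–Schmidt norm has a
square integrable kernel (`hasKernel_of_hsNormSq`), unique almost everywhere and of the same norm
(`lintegral_kernel_sq`). With `T = χ γ χ`, the three operators `A = χ γ^p χ`, `T^p` and `χ γ^p` all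
satisfy `A A* ≤ T`, because `t^{2p} ≤ t` on `[0, 1]` for `p ≥ 1/2`, and `T = B B*` for the
Hilbert–Schmidt operator `B = χ γ^{1/2}`; so all three have kernels.

*Monotonicity of the exchange energy.* The Coulomb potential is a superposition with positive
weights of products `g(x) g(y)` with Gaussians `g` (`coulomb_eq_lintegral`). Hence `X(A)` is a
superposition of the squared Hilbert–Schmidt norms of `g A g` (`lintegral_kernel_coulomb`), and as `0 ≤ A ≤ B`
implies `tr A² ≤ tr B²`, also `X(A) ≤ X(B)` (`exchange_mono`). The first inequality follows from
Hansen's inequality `χ γ^p χ ≤ (χ γ χ)^p` (`mul_power_mul_le`), a consequence of the operator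
monotonicity of `t ↦ t^q` for `0 ≤ q ≤ 1`.

*Kinetic bound.* The radial field `v(x) = x / |x|` satisfies `|v| ≤ 1` and `div v = 2 / |x|`.
Integration by parts gives, for a kernel `k` and every `l > 0`,
`2 ∬ |k|² / |x - y| ≤ 2 ∬ |∇ₓ k| |k| ≤ l⁻¹ ‖∇ A‖² + l ‖A‖²` (`IsKernel.coulomb_le`). To avoid weak
derivatives, derivatives are replaced by difference quotients: each component `v_j` increases in its
own direction, so Fatou's lemma applies to the divergence, and the difference quotients of `k` are
bounded by the kinetic energy in Fourier space. For `A = χ γ^p` the inequality `A A* ≤ T` yields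
`‖∇ A‖² ≤ tr(-Δ T)` (`tsum_kineticForm_le_kineticTrace`) and `‖A‖² ≤ ‖χ γ^{1/2}‖² = ∫ χ² ρ_γ`
(`lintegral_density`, by the spectral theorem for `γ`). The second inequality, even without the
factor `1/2` of `X`, results from optimizing over `l` (`le_sqrt_mul_sqrt`). -/

namespace DensityMatrix

noncomputable section

/-! ### Hilbert–Schmidt norms -/

section HilbertSchmidt

variable {ι κ H : Type*} [NormedAddCommGroup H] [InnerProductSpace ℂ H]

/-- Parseval's identity in `[0, ∞]`. -/
theorem tsum_enorm_inner_sq (b : HilbertBasis ι ℂ H) (x : H) :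
    ∑' i, ‖⟪b i, x⟫_ℂ‖ₑ ^ 2 = ‖x‖ₑ ^ 2 := by
  have h := b.hasSum_inner_mul_inner x x
  have h2 : HasSum (fun i => ‖⟪b i, x⟫_ℂ‖ ^ 2) (‖x‖ ^ 2) := by
    have h3 := Complex.hasSum_re h
    rw [inner_self_eq_norm_sq_to_K] at h3
    convert h3 using 1
    · funext i
      rw [← inner_conj_symm x (b i), Complex.conj_mul', ← Complex.ofReal_pow, Complex.ofReal_re]
    · rw [← Complex.ofReal_re (‖x‖ ^ 2)]
      simp
  have h4 := ENNReal.ofReal_tsum_of_nonneg (fun i => sq_nonneg ‖⟪b i, x⟫_ℂ‖) h2.summable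
  rw [h2.tsum_eq, ENNReal.ofReal_pow (norm_nonneg _), ofReal_norm] at h4
  rw [h4]
  exact tsum_congr fun i => by rw [ENNReal.ofReal_pow (norm_nonneg _), ofReal_norm]

/-- The squared Hilbert–Schmidt norm `∑ ‖A bᵢ‖²`, with values in `[0, ∞]`, computed in the
orthonormal basis `b`; it does not depend on `b`. -/
def hsNormSq (b : HilbertBasis ι ℂ H) (A : H →L[ℂ] H) : ℝ≥0∞ := ∑' i, ‖A (b i)‖ₑ ^ 2

theorem re_inner_le_re_inner {A B : H →L[ℂ] H} (h : A ≤ B) (x : H) :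
    (⟪x, A x⟫_ℂ).re ≤ (⟪x, B x⟫_ℂ).re := by
  have := (ContinuousLinearMap.le_def _ _ |>.1 h).re_inner_nonneg_right x
  simpa [inner_sub_right] using this

/-- The trace of a form over an orthonormal basis is at most its trace over all orthonormal
systems. -/
theorem tsum_le_formTrace (b : HilbertBasis ι ℂ H) (q : H → ℝ≥0∞) :
    ∑' i, q (b i) ≤ formTrace q := by
  classical
  rw [ENNReal.tsum_eq_iSup_sum]
  refine iSup_le fun s => ?_
  have hinj : Function.Injective b := b.orthonormal.linearIndependent.injective
  refine le_trans (le_of_eq ?_) (le_iSup₂_of_le (s.image b) ?_ le_rfl)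
  · rw [Finset.sum_image fun x _ y _ h => hinj h]
  · have h := b.orthonormal.toSubtypeRange
    have hm : ∀ f : (s.image b : Finset H), (f : H) ∈ Set.range b := fun f => by
      obtain ⟨i, -, hi⟩ := Finset.mem_image.1 f.2
      exact ⟨i, hi⟩
    exact h.comp (fun f : {f // f ∈ s.image b} => (⟨f, hm f⟩ : Set.range b)) fun x y hxy =>
      Subtype.ext (congrArg Subtype.val hxy :)

variable [CompleteSpace H]

theorem hsNormSq_star (b : HilbertBasis ι ℂ H) (c : HilbertBasis κ ℂ H) (A : H →L[ℂ] H) :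
    hsNormSq b (star A) = hsNormSq c A := by
  unfold hsNormSq
  simp_rw [← tsum_enorm_inner_sq c (star A (b _)), ← tsum_enorm_inner_sq b (A (c _))]
  rw [ENNReal.tsum_comm]
  refine tsum_congr fun j => tsum_congr fun i => ?_
  rw [ContinuousLinearMap.star_eq_adjoint, ContinuousLinearMap.adjoint_inner_right,
    ← ofReal_norm, norm_inner_symm, ofReal_norm]

theorem hsNormSq_eq (b : HilbertBasis ι ℂ H) (c : HilbertBasis κ ℂ H) (A : H →L[ℂ] H) :
    hsNormSq b A = hsNormSq c A := by
  rw [← hsNormSq_star b b A, hsNormSq_star b c A]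

theorem enorm_star_apply_sq (A : H →L[ℂ] H) (x : H) :
    ‖star A x‖ₑ ^ 2 = ENNReal.ofReal (⟪x, (A * star A) x⟫_ℂ).re := by
  rw [mul_apply_eq_comp, ContinuousLinearMap.star_eq_adjoint,
    ← ContinuousLinearMap.adjoint_inner_left, inner_self_eq_norm_sq_to_K, ← ofReal_norm,
    ← ENNReal.ofReal_pow (norm_nonneg _)]
  congr 1
  rw [← Complex.ofReal_re (‖_‖ ^ 2)]
  simp

/-- Monotonicity of the Hilbert–Schmidt norm: `A A* ≤ B B*` gives `‖M A‖ ≤ ‖M B‖`, since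
`‖M A‖² = ∑ ⟨M* bᵢ, A A* M* bᵢ⟩`. -/
theorem hsNormSq_mul_le (b : HilbertBasis ι ℂ H) {A B : H →L[ℂ] H}
    (h : A * star A ≤ B * star B) (M : H →L[ℂ] H) :
    hsNormSq b (M * A) ≤ hsNormSq b (M * B) := by
  rw [← hsNormSq_star b b (M * A), ← hsNormSq_star b b (M * B)]
  refine ENNReal.tsum_le_tsum fun i => ?_
  simp only [star_mul, mul_apply_eq_comp]
  rw [enorm_star_apply_sq, enorm_star_apply_sq]
  exact ENNReal.ofReal_le_ofReal (re_inner_le_re_inner h _)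

theorem hsNormSq_le (b : HilbertBasis ι ℂ H) {A B : H →L[ℂ] H}
    (h : A * star A ≤ B * star B) : hsNormSq b A ≤ hsNormSq b B := by
  simpa using hsNormSq_mul_le b h 1

/-- `0 ≤ A ≤ B` implies `tr A² ≤ tr B²`: both are compared with `tr A^{1/2} B A^{1/2}`. -/
theorem hsNormSq_le_of_le (b : HilbertBasis ι ℂ H) {A B : H →L[ℂ] H} (hA : 0 ≤ A)
    (h : A ≤ B) : hsNormSq b A ≤ hsNormSq b B := by
  have hB : 0 ≤ B := hA.trans h
  have sA : star (CFC.sqrt A) = CFC.sqrt A := (CFC.sqrt_nonneg A).isSelfAdjoint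
  have sB : star (CFC.sqrt B) = CFC.sqrt B := (CFC.sqrt_nonneg B).isSelfAdjoint
  have key : CFC.sqrt A * star (CFC.sqrt A) ≤ CFC.sqrt B * star (CFC.sqrt B) := by
    rwa [sA, sB, CFC.sqrt_mul_sqrt_self A, CFC.sqrt_mul_sqrt_self B]
  calc hsNormSq b A = hsNormSq b (CFC.sqrt A * CFC.sqrt A) := by rw [CFC.sqrt_mul_sqrt_self A]
    _ ≤ hsNormSq b (CFC.sqrt A * CFC.sqrt B) := hsNormSq_mul_le b key _
    _ = hsNormSq b (CFC.sqrt B * CFC.sqrt A) := by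
        rw [← hsNormSq_star b b, star_mul, sA, sB]
    _ ≤ hsNormSq b (CFC.sqrt B * CFC.sqrt B) := hsNormSq_mul_le b key _
    _ = hsNormSq b B := by rw [CFC.sqrt_mul_sqrt_self B]

theorem hsNormSq_sqrt (b : HilbertBasis ι ℂ H) {A : H →L[ℂ] H} (hA : 0 ≤ A) :
    hsNormSq b (CFC.sqrt A) = ∑' i, ENNReal.ofReal (⟪b i, A (b i)⟫_ℂ).re := by
  have sA : star (CFC.sqrt A) = CFC.sqrt A := (CFC.sqrt_nonneg A).isSelfAdjoint
  refine tsum_congr fun i => ?_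
  conv_lhs => rw [← sA]
  rw [enorm_star_apply_sq, sA, CFC.sqrt_mul_sqrt_self A]

/-- The square root of a positive trace class operator is Hilbert–Schmidt. -/
theorem hsNormSq_sqrtOp_lt_top (b : HilbertBasis ι ℂ H) {A : H →L[ℂ] H} (hA : 0 ≤ A)
    (h : IsTraceClass A) : hsNormSq b (sqrtOp A) < ⊤ := by
  rw [sqrtOp, hsNormSq_sqrt b hA]
  refine (tsum_le_formTrace b fun f => ENNReal.ofReal (⟪f, A f⟫_ℂ).re).trans_lt ?_
  have : absOp A = A := CFC.abs_of_nonneg A hA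
  simpa [IsTraceClass, this] using h

theorem star_sqrtOp (A : H →L[ℂ] H) : star (sqrtOp A) = sqrtOp A :=
  (CFC.sqrt_nonneg A).isSelfAdjoint

theorem sqrtOp_mul_self {A : H →L[ℂ] H} (hA : 0 ≤ A) : sqrtOp A * sqrtOp A = A :=
  CFC.sqrt_mul_sqrt_self A

end HilbertSchmidt

/-! ### Powers of positive operators -/

section Powers

variable {H : Type*} [NormedAddCommGroup H] [InnerProductSpace ℂ H] [CompleteSpace H]

/-- An intertwiner of two self-adjoint operators intertwines their functional calculi. -/
theorem cfc_intertwine {a b x : H →L[ℂ] H} (ha : IsSelfAdjoint a) (hb : IsSelfAdjoint b)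
    (hx : x * a = b * x) {f : ℝ → ℝ} (hf : ContinuousOn f (spectrum ℝ a ∪ spectrum ℝ b)) :
    x * cfc f a = cfc f b * x := by
  set K := spectrum ℝ a ∪ spectrum ℝ b with hK
  have hKc : IsCompact K :=
    (ContinuousFunctionalCalculus.isCompact_spectrum a).union
      (ContinuousFunctionalCalculus.isCompact_spectrum b)
  have : CompactSpace K := isCompact_iff_compactSpace.1 hKc
  have hsa : spectrum ℝ a ⊆ K := Set.subset_union_left
  have hsb : spectrum ℝ b ⊆ K := Set.subset_union_right
  have key : ∀ g : C(K, ℝ), x * cfcHomSuperset ha hsa g = cfcHomSuperset hb hsb g * x := by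
    intro g
    induction g using ContinuousMap.induction_on_of_compact with
    | const r =>
      have h1 : (ContinuousMap.const K r) = algebraMap ℝ C(K, ℝ) r := rfl
      rw [h1, AlgHomClass.commutes, AlgHomClass.commutes, Algebra.commutes]
    | id =>
      rw [cfcHomSuperset_id ha hsa, cfcHomSuperset_id hb hsb, hx]
    | star_id =>
      rw [map_star, map_star, cfcHomSuperset_id ha hsa, cfcHomSuperset_id hb hsb,
        ha.star_eq, hb.star_eq, hx]
    | add f g hf hg => rw [map_add, map_add, mul_add, add_mul, hf, hg]
    | mul f g hf hg => rw [map_mul, map_mul, ← mul_assoc, hf, mul_assoc, hg, mul_assoc]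
    | frequently f h =>
      have hcl : IsClosed {g : C(K, ℝ) | x * cfcHomSuperset ha hsa g =
          cfcHomSuperset hb hsb g * x} :=
        isClosed_eq (continuous_const.mul (cfcHomSuperset_continuous ha hsa))
          ((cfcHomSuperset_continuous hb hsb).mul continuous_const)
      exact hcl.mem_of_frequently_of_tendsto h Filter.tendsto_id
  have := key ⟨K.domRestrict f, hf.domRestrict⟩
  rw [cfcHomSuperset_apply, cfcHomSuperset_apply] at this
  rw [cfc_apply f a ha (hf.mono hsa), cfc_apply f b hb (hf.mono hsb)]
  exact this

/-- `A^{2p} ≤ A` for `0 ≤ A ≤ 1` and `p ≥ 1/2`. -/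
theorem power_mul_power_le {A : H →L[ℂ] H} (hA : 0 ≤ A) (hA1 : A ≤ 1) {p : ℝ} (hp : 1 / 2 ≤ p) :
    power A p * power A p ≤ A := by
  have hs : IsSelfAdjoint A := hA.isSelfAdjoint
  have hc : ContinuousOn (fun t : ℝ => t ^ p) (spectrum ℝ A) :=
    (Real.continuous_rpow_const (by linarith)).continuousOn
  have h1 : ∀ t ∈ spectrum ℝ A, t ≤ 1 := by
    rw [← le_algebraMap_iff_spectrum_le hs, map_one]
    exact hA1
  rw [power, CFC.rpow_eq_cfc_real hA, ← cfc_mul _ _ A hc hc]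
  conv_rhs => rw [← cfc_id' ℝ A]
  refine cfc_mono (fun t ht => ?_) (hc.mul hc) continuousOn_id
  have h0 := spectrum_nonneg_of_nonneg hA ht
  rw [← Real.rpow_add_of_nonneg h0 (by linarith) (by linarith)]
  calc t ^ (p + p) ≤ t ^ (1 : ℝ) :=
        Real.rpow_le_rpow_of_exponent_ge' h0 (h1 t ht) (by norm_num) (by linarith)
    _ = t := Real.rpow_one t

theorem power_nonneg (A : H →L[ℂ] H) (p : ℝ) : 0 ≤ power A p := CFC.rpow_nonneg

theorem star_power (A : H →L[ℂ] H) (p : ℝ) : star (power A p) = power A p :=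
  (power_nonneg A p).isSelfAdjoint

theorem algebraMap_isStrictlyPositive {ε : ℝ} (hε : 0 < ε) :
    IsStrictlyPositive (algebraMap ℝ (H →L[ℂ] H) ε) :=
  ⟨algebraMap_nonneg _ hε.le, (IsUnit.mk0 ε hε.ne').map (algebraMap ℝ (H →L[ℂ] H))⟩

/-- The powers of `A + ε`, written as functions of `A`. -/
theorem cfc_add_rpow {A : H →L[ℂ] H} (hA : 0 ≤ A) {ε : ℝ} (hε : 0 < ε) (q : ℝ) :
    cfc (fun t : ℝ => (t + ε) ^ q) A = (A + algebraMap ℝ _ ε) ^ q := by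
  have hs : IsSelfAdjoint A := hA.isSelfAdjoint
  have h0 : 0 ≤ A + algebraMap ℝ (H →L[ℂ] H) ε :=
    add_nonneg hA (algebraMap_isStrictlyPositive hε).nonneg
  have h1 : cfc (fun t : ℝ => t + ε) A = A + algebraMap ℝ (H →L[ℂ] H) ε := by
    rw [cfc_add_const ε (fun t => t) A, cfc_id' ℝ A]
  rw [CFC.rpow_eq_cfc_real h0, ← h1, ← cfc_comp (fun t : ℝ => t ^ q) (fun t => t + ε) A (hg := ?_)]
  · rfl
  · refine fun t ht => (Real.continuousAt_rpow_const _ _ (Or.inl ?_)).continuousWithinAt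
    obtain ⟨u, hu, rfl⟩ := ht
    have := spectrum_nonneg_of_nonneg hA hu
    positivity

/-- The functions `(t + ε) ^ q` with `-1 ≤ q < 0` are operator antitone. -/
theorem cfc_add_rpow_antitone {A B : H →L[ℂ] H} (hA : 0 ≤ A) (hAB : A ≤ B) {ε : ℝ} (hε : 0 < ε)
    {q : ℝ} (hq : q < 0) (hq1 : -1 ≤ q) :
    cfc (fun t : ℝ => (t + ε) ^ q) B ≤ cfc (fun t : ℝ => (t + ε) ^ q) A := by
  have hA' : IsStrictlyPositive (A + algebraMap ℝ (H →L[ℂ] H) ε) :=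
    (algebraMap_isStrictlyPositive hε).nonneg_add hA
  have hAB' : A + algebraMap ℝ (H →L[ℂ] H) ε ≤ B + algebraMap ℝ (H →L[ℂ] H) ε := by gcongr
  have hB' := hA'.of_le hAB'
  rw [cfc_add_rpow hA hε, cfc_add_rpow (hA.trans hAB) hε]
  have h1 := CFC.rpow_le_rpow (p := -q) ⟨by linarith, by linarith⟩ hAB'
  have h2 := CStarAlgebra.rpow_neg_one_le_rpow_neg_one h1 (hA'.rpow _ _)
  rw [CFC.rpow_rpow _ _ _ (by linarith) hA', CFC.rpow_rpow _ _ _ (by linarith) hB'] at h2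
  simpa using h2

/-- Hansen's inequality `c A^p c ≤ (c A c)^p` for a self-adjoint contraction `c` and `0 < p ≤ 1`.
With `T = A^{1/2} c` one has `T T* ≤ A`, hence `f(A) ≤ f(T T*)` for the operator antitone
`f(t) = (t + ε)^(p - 1)`, and `T* f(T T*) T = f(T* T) T* T`; now let `ε → 0`. -/
theorem mul_power_mul_le {A c : H →L[ℂ] H} (hA : 0 ≤ A) (hc : IsSelfAdjoint c) (hc1 : c * c ≤ 1)
    {p : ℝ} (hp0 : 0 < p) (hp1 : p ≤ 1) :
    c * power A p * c ≤ power (c * A * c) p := by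
  have hB : 0 ≤ c * A * c := hc.conjugate_nonneg hA
  rcases hp1.eq_or_lt with rfl | hp1
  · rw [power, power, CFC.rpow_one A, CFC.rpow_one _ hB]
  have sA : IsSelfAdjoint A := hA.isSelfAdjoint
  have sB : IsSelfAdjoint (c * A * c) := hB.isSelfAdjoint
  obtain ⟨s, ss, hss⟩ : ∃ s : H →L[ℂ] H, IsSelfAdjoint s ∧ s * s = A :=
    ⟨CFC.sqrt A, (CFC.sqrt_nonneg A).isSelfAdjoint, CFC.sqrt_mul_sqrt_self A⟩
  obtain ⟨T, hT⟩ : ∃ T, T = s * c := ⟨_, rfl⟩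
  have hTs : star T = c * s := by rw [hT, star_mul, hc.star_eq, ss.star_eq]
  have hTT : star T * T = c * A * c := by
    rw [hTs, hT, ← hss]
    simp only [mul_assoc]
  have hTT0 : 0 ≤ T * star T := mul_star_self_nonneg T
  have hTTA : T * star T ≤ A := by
    have := ss.conjugate_le_conjugate hc1
    rw [mul_one, hss] at this
    rw [hTs, hT]
    simpa only [mul_assoc] using this
  have hcp : ∀ s : Set ℝ, ContinuousOn (fun t : ℝ => t ^ p) s := fun s =>
    (Real.continuous_rpow_const hp0.le).continuousOn
  have main : ∀ ε : ℝ, 0 < ε →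
      c * power A p * c ≤ power (c * A * c) p + algebraMap ℝ _ (ε ^ p) := by
    intro ε hε
    have hcf : ∀ s : Set ℝ, (∀ t ∈ s, 0 ≤ t) → ContinuousOn (fun t : ℝ => (t + ε) ^ (p - 1)) s :=
      fun s hs => (continuous_id.add continuous_const).continuousOn.rpow_const fun t ht =>
        Or.inl (add_pos_of_nonneg_of_pos (hs t ht) hε).ne'
    have hcg : ∀ s : Set ℝ, (∀ t ∈ s, 0 ≤ t) →
        ContinuousOn (fun t : ℝ => (t + ε) ^ (p - 1) * t) s :=
      fun s hs => (hcf s hs).mul continuousOn_id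
    have specA : ∀ t ∈ spectrum ℝ A, 0 ≤ t := fun t ht => spectrum_nonneg_of_nonneg hA ht
    have specB : ∀ t ∈ spectrum ℝ (c * A * c), 0 ≤ t := fun t ht => spectrum_nonneg_of_nonneg hB ht
    have hg : ∀ {D : H →L[ℂ] H}, 0 ≤ D → cfc (fun t : ℝ => (t + ε) ^ (p - 1) * t) D =
        cfc (fun t : ℝ => (t + ε) ^ (p - 1)) D * D := by
      intro D hD
      rw [cfc_mul (fun t : ℝ => (t + ε) ^ (p - 1)) (fun t => t) D
        (hcf _ fun t ht => spectrum_nonneg_of_nonneg hD ht) continuousOn_id,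
        cfc_id' ℝ D hD.isSelfAdjoint]
    -- `t^p ≤ (t + ε)^(p - 1) (t + ε) ≤ (t + ε)^(p - 1) t + ε^p`
    have h1 : power A p ≤ cfc (fun t : ℝ => (t + ε) ^ (p - 1) * t) A + algebraMap ℝ _ (ε ^ p) := by
      rw [power, CFC.rpow_eq_cfc_real hA, ← cfc_add_const _ _ A (hcg _ specA)]
      refine cfc_mono (fun t ht => ?_) (hcp _) ((hcg _ specA).add continuousOn_const)
      have h0 := specA t ht
      have hpos : 0 < t + ε := by positivity
      have e1 : (t + ε) ^ p = (t + ε) ^ (p - 1) * (t + ε) := by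
        rw [← Real.rpow_add_one hpos.ne']; simp
      have e2 : ε ^ p = ε ^ (p - 1) * ε := by rw [← Real.rpow_add_one hε.ne']; simp
      have e3 : t ^ p ≤ (t + ε) ^ p := Real.rpow_le_rpow h0 (by linarith) hp0.le
      have e4 : (t + ε) ^ (p - 1) ≤ ε ^ (p - 1) :=
        Real.rpow_le_rpow_of_nonpos hε (by linarith) (by linarith)
      nlinarith
    have h2 : c * cfc (fun t : ℝ => (t + ε) ^ (p - 1) * t) A * c ≤
        cfc (fun t : ℝ => (t + ε) ^ (p - 1) * t) (c * A * c) := by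
      have e1 : c * cfc (fun t : ℝ => (t + ε) ^ (p - 1) * t) A * c =
          star T * cfc (fun t : ℝ => (t + ε) ^ (p - 1)) A * T := by
        have hcomm : Commute A s := by
          rw [Commute, SemiconjBy, ← hss, mul_assoc]
        have := (hcomm.cfc_real (fun t : ℝ => (t + ε) ^ (p - 1))).eq
        rw [hg hA, hTs, hT, mul_assoc c s, ← this]
        simp only [mul_assoc, ← hss]
      have e2 : star T * cfc (fun t : ℝ => (t + ε) ^ (p - 1)) (T * star T) =
          cfc (fun t : ℝ => (t + ε) ^ (p - 1)) (c * A * c) * star T := by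
        refine cfc_intertwine hTT0.isSelfAdjoint sB ?_ (hcf _ ?_)
        · rw [← hTT, ← mul_assoc]
        · rintro t (ht | ht)
          exacts [spectrum_nonneg_of_nonneg hTT0 ht, spectrum_nonneg_of_nonneg hB ht]
      calc c * cfc (fun t : ℝ => (t + ε) ^ (p - 1) * t) A * c
          = star T * cfc (fun t : ℝ => (t + ε) ^ (p - 1)) A * T := e1
        _ ≤ star T * cfc (fun t : ℝ => (t + ε) ^ (p - 1)) (T * star T) * T :=
            star_left_conjugate_le_conjugate
              (cfc_add_rpow_antitone hTT0 hTTA hε (by linarith) (by linarith)) T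
        _ = cfc (fun t : ℝ => (t + ε) ^ (p - 1) * t) (c * A * c) := by
            rw [e2, mul_assoc, hTT, hg hB]
    have h3 : cfc (fun t : ℝ => (t + ε) ^ (p - 1) * t) (c * A * c) ≤ power (c * A * c) p := by
      rw [power, CFC.rpow_eq_cfc_real hB]
      refine cfc_mono (fun t ht => ?_) (hcg _ specB) (hcp _)
      rcases (specB t ht).eq_or_lt with rfl | h0
      · simp [Real.zero_rpow hp0.ne']
      have e1 : t ^ p = t ^ (p - 1) * t := by rw [← Real.rpow_add_one h0.ne']; simp
      rw [e1]
      exact mul_le_mul_of_nonneg_right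
        (Real.rpow_le_rpow_of_nonpos h0 (by linarith) (by linarith)) h0.le
    have h4 : c * algebraMap ℝ (H →L[ℂ] H) (ε ^ p) * c ≤ algebraMap ℝ _ (ε ^ p) := by
      rw [← Algebra.commutes, mul_assoc, ← Algebra.smul_def, Algebra.algebraMap_eq_smul_one]
      exact smul_le_smul_of_nonneg_left hc1 (by positivity)
    calc c * power A p * c
        ≤ c * (cfc (fun t : ℝ => (t + ε) ^ (p - 1) * t) A + algebraMap ℝ _ (ε ^ p)) * c :=
          hc.conjugate_le_conjugate h1
      _ = c * cfc (fun t : ℝ => (t + ε) ^ (p - 1) * t) A * c +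
          c * algebraMap ℝ _ (ε ^ p) * c := by rw [mul_add, add_mul]
      _ ≤ power (c * A * c) p + algebraMap ℝ _ (ε ^ p) := add_le_add (h2.trans h3) h4
  have hlim : Filter.Tendsto (fun ε : ℝ => power (c * A * c) p + algebraMap ℝ (H →L[ℂ] H) (ε ^ p))
      (nhdsWithin 0 (Set.Ioi 0)) (nhds (power (c * A * c) p + algebraMap ℝ (H →L[ℂ] H) 0)) := by
    refine tendsto_const_nhds.add (((continuous_algebraMap ℝ _).tendsto 0).comp ?_)
    have := (Real.continuous_rpow_const hp0.le).tendsto 0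
    rw [Real.zero_rpow hp0.ne'] at this
    exact this.mono_left nhdsWithin_le_nhds
  rw [map_zero, add_zero] at hlim
  exact ge_of_tendsto hlim (eventually_mem_nhdsWithin.mono fun ε hε => main ε hε)

end Powers

/-! ### Integral kernels -/

section Kernels

theorem Lp_enorm_sq {α E : Type*} [MeasurableSpace α] [NormedAddCommGroup E] {μ : Measure α}
    (f : Lp E 2 μ) : ‖f‖ₑ ^ 2 = ∫⁻ x, ‖f x‖ₑ ^ 2 ∂μ := by
  have := eLpNorm_nnreal_pow_eq_lintegral (μ := μ) (f := f) (p := 2) (by norm_num)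
  simpa [Lp.enorm_def] using this

theorem memLp_two_iff_lintegral {α E : Type*} [MeasurableSpace α] [NormedAddCommGroup E]
    {μ : Measure α} {f : α → E} :
    MemLp f 2 μ ↔ AEStronglyMeasurable f μ ∧ ∫⁻ x, ‖f x‖ₑ ^ 2 ∂μ < ⊤ := by
  have := eLpNorm_nnreal_pow_eq_lintegral (μ := μ) (f := f) (p := 2) (by norm_num)
  simp only [NNReal.coe_ofNat, ENNReal.rpow_ofNat, ENNReal.coe_ofNat] at this
  rw [← this, MemLp]
  simp

theorem ae_memLp_section {k : R3 × R3 → ℂ} (hk : MemLp k 2 volume) :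
    ∀ᵐ x : R3, MemLp (fun y => k (x, y)) 2 volume := by
  obtain ⟨h1, h2⟩ := memLp_two_iff_lintegral.1 hk
  rw [Measure.volume_eq_prod] at h1 h2
  rw [lintegral_prod _ (h1.enorm.pow_const 2)] at h2
  filter_upwards [h1.prodMk_left, ae_lt_top' (h1.enorm.pow_const 2).lintegral_prod_right' h2.ne]
    with x hx hx'
  exact memLp_two_iff_lintegral.2 ⟨hx, hx'⟩

/-- The squared norm of a kernel is the squared Hilbert–Schmidt norm of its operator: for almost
every `x`, Parseval's identity for `k(x, ·)` reads `∑ |(A bᵢ)(x)|² = ∫ |k(x, y)|² dy`. -/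
theorem lintegral_kernel_sq {ι : Type*} [Countable ι] (b : HilbertBasis ι ℂ L2) {A : Op}
    {k : R3 × R3 → ℂ} (hk : IsKernel A k) : ∫⁻ z, ‖k z‖ₑ ^ 2 = hsNormSq b A := by
  have h1 := (memLp_two_iff_lintegral.1 hk.1).1
  rw [Measure.volume_eq_prod] at h1 ⊢
  rw [lintegral_prod _ (h1.enorm.pow_const 2), hsNormSq]
  simp_rw [Lp_enorm_sq]
  rw [← lintegral_tsum fun i => (Lp.aestronglyMeasurable _).enorm.pow_const 2]
  refine lintegral_congr_ae ?_
  filter_upwards [ae_memLp_section hk.1, ae_all_iff.2 fun i => hk.2 (b i)] with x hx hAx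
  have hx' : MemLp (fun y => star (k (x, y))) 2 (volume : Measure R3) := hx.star
  have hg : ∫⁻ y, ‖k (x, y)‖ₑ ^ 2 = ‖hx'.toLp‖ₑ ^ 2 := by
    rw [Lp_enorm_sq]
    refine lintegral_congr_ae ?_
    filter_upwards [hx'.coeFn_toLp] with y hy
    rw [hy, ← ofReal_norm (star _), norm_star, ofReal_norm]
  rw [hg, ← tsum_enorm_inner_sq b]
  refine tsum_congr fun i => ?_
  rw [hAx i, ← ofReal_norm, norm_inner_symm, ofReal_norm, L2.inner_def]
  congr 2
  refine integral_congr_ae ?_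
  filter_upwards [hx'.coeFn_toLp] with y hy
  rw [hy, RCLike.inner_apply]
  simp [mul_comm]

theorem ae_integrable_section_mul {k : R3 × R3 → ℂ} (hk : MemLp k 2 volume) (f : L2) :
    ∀ᵐ x : R3, Integrable (fun y => k (x, y) * f y) volume := by
  filter_upwards [ae_memLp_section hk] with x hx
  exact hx.integrable_mul (Lp.memLp f)

theorem IsKernel.sub {A B : Op} {k l : R3 × R3 → ℂ} (hk : IsKernel A k) (hl : IsKernel B l) :
    IsKernel (A - B) (k - l) := by
  refine ⟨hk.1.sub hl.1, fun f => ?_⟩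
  filter_upwards [Lp.coeFn_sub (A f) (B f), hk.2 f, hl.2 f, ae_integrable_section_mul hk.1 f,
    ae_integrable_section_mul hl.1 f] with x h1 h2 h3 h4 h5
  rw [sub_apply, h1, Pi.sub_apply, h2, h3, ← integral_sub h4 h5]
  simp [sub_mul]

theorem IsKernel.ae_eq (b : HilbertBasis ℕ ℂ L2) {A : Op} {k l : R3 × R3 → ℂ}
    (hk : IsKernel A k) (hl : IsKernel A l) : k =ᵐ[volume] l := by
  have h := lintegral_kernel_sq b (hk.sub hl)
  rw [sub_self, show hsNormSq b (0 : Op) = 0 by simp [hsNormSq]] at h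
  rw [lintegral_eq_zero_iff' ((hk.1.sub hl.1).1.enorm.pow_const 2)] at h
  filter_upwards [h] with z hz
  simpa [sub_eq_zero] using hz

theorem memLp_tensor (g f : L2) :
    MemLp (fun z : R3 × R3 => g z.1 * star (f z.2)) 2 volume := by
  have hg := memLp_two_iff_lintegral.1 (Lp.memLp g)
  have hf := memLp_two_iff_lintegral.1 (Lp.memLp f)
  have hm : AEStronglyMeasurable (fun z : R3 × R3 => g z.1 * star (f z.2)) volume := by
    rw [Measure.volume_eq_prod]
    exact hg.1.comp_fst.mul hf.1.star.comp_snd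
  refine memLp_two_iff_lintegral.2 ⟨hm, ?_⟩
  have : ∀ z : R3 × R3, ‖g z.1 * star (f z.2)‖ₑ ^ 2 = ‖g z.1‖ₑ ^ 2 * ‖f z.2‖ₑ ^ 2 := by
    intro z
    rw [enorm_mul, mul_pow, ← ofReal_norm (star _), norm_star, ofReal_norm]
  simp_rw [this]
  rw [Measure.volume_eq_prod, lintegral_prod_mul (f := fun x => ‖g x‖ₑ ^ 2)
    (g := fun y => ‖f y‖ₑ ^ 2) (hg.1.enorm.pow_const 2)
    (hf.1.enorm.pow_const 2)]
  exact ENNReal.mul_lt_top hg.2 hf.2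

/-- The rank one kernel `g(x) conj(f(y))`, as an element of `L²(ℝ³ × ℝ³)`. -/
def tensor (g f : L2) : Lp ℂ 2 (volume : Measure (R3 × R3)) := (memLp_tensor g f).toLp

theorem inner_tensor (g f g' f' : L2) :
    ⟪tensor g f, tensor g' f'⟫_ℂ = ⟪g, g'⟫_ℂ * ⟪f', f⟫_ℂ := by
  rw [L2.inner_def, L2.inner_def, L2.inner_def, ← integral_prod_mul, ← Measure.volume_eq_prod]
  refine integral_congr_ae ?_
  filter_upwards [(memLp_tensor g f).coeFn_toLp, (memLp_tensor g' f').coeFn_toLp] with z h1 h2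
  rw [tensor, tensor, h1, h2]
  simp only [RCLike.inner_apply, map_mul, RCLike.star_def, RCLike.conj_conj]
  ring

theorem memLp_integral_kernel {k : R3 × R3 → ℂ} (hk : MemLp k 2 volume) (f : L2) :
    MemLp (fun x => ∫ y, k (x, y) * f y) 2 (volume : Measure R3) := by
  have hk' := memLp_two_iff_lintegral.1 hk
  have hf := memLp_two_iff_lintegral.1 (Lp.memLp f)
  rw [Measure.volume_eq_prod] at hk'
  have hm : AEStronglyMeasurable (fun z : R3 × R3 => k z * f z.2) (volume.prod volume) :=
    hk'.1.mul hf.1.comp_snd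
  refine memLp_two_iff_lintegral.2 ⟨hm.integral_prod_right', ?_⟩
  have hb : ∀ᵐ x : R3, ‖∫ y, k (x, y) * f y‖ₑ ^ 2 ≤
      (∫⁻ y, ‖k (x, y)‖ₑ ^ 2) * ∫⁻ y, ‖f y‖ₑ ^ 2 := by
    filter_upwards [hk'.1.prodMk_left] with x hx
    have h1 : ‖∫ y, k (x, y) * f y‖ₑ ≤ ∫⁻ y, ‖k (x, y)‖ₑ * ‖f y‖ₑ :=
      (enorm_integral_le_lintegral_enorm _).trans_eq (by simp_rw [enorm_mul])
    have h2 := ENNReal.lintegral_mul_le_Lp_mul_Lq volume Real.HolderConjugate.two_two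
      hx.enorm hf.1.enorm
    simp only [Pi.mul_apply, ENNReal.rpow_ofNat] at h2
    calc ‖∫ y, k (x, y) * f y‖ₑ ^ 2 ≤ _ := pow_le_pow_left' (h1.trans h2) 2
      _ = _ := by
        rw [mul_pow, ← ENNReal.rpow_natCast, ← ENNReal.rpow_natCast, ← ENNReal.rpow_mul,
          ← ENNReal.rpow_mul]
        norm_num
  refine (lintegral_mono_ae hb).trans_lt ?_
  rw [lintegral_mul_const' _ _ hf.2.ne]
  refine ENNReal.mul_lt_top ?_ hf.2
  rw [← lintegral_prod _ (hk'.1.enorm.pow_const 2)]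
  exact hk'.2

/-- The matrix element `⟨g, A f⟩` of the operator with kernel `k` is an inner product in
`L²(ℝ³ × ℝ³)`. -/
theorem inner_tensor_kernel {k : R3 × R3 → ℂ} (hk : MemLp k 2 volume) (g f : L2) :
    ⟪tensor g f, hk.toLp⟫_ℂ = ⟪g, (memLp_integral_kernel hk f).toLp⟫_ℂ := by
  have hint := L2.integrable_inner (𝕜 := ℂ) (tensor g f) hk.toLp
  have hae : (fun z => ⟪tensor g f z, (hk.toLp : Lp ℂ 2 (volume : Measure (R3 × R3))) z⟫_ℂ)
      =ᵐ[volume] fun z : R3 × R3 => star (g z.1) * (k z * f z.2) := by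
    filter_upwards [(memLp_tensor g f).coeFn_toLp, hk.coeFn_toLp] with z h1 h2
    rw [tensor, h1, h2]
    simp only [RCLike.inner_apply, map_mul, RCLike.star_def, RCLike.conj_conj]
    ring
  rw [L2.inner_def, L2.inner_def, integral_congr_ae hae]
  have hint' := hint.congr hae
  rw [Measure.volume_eq_prod] at hint' ⊢
  rw [integral_prod _ hint']
  refine integral_congr_ae ?_
  filter_upwards [(memLp_integral_kernel hk f).coeFn_toLp] with x hx
  rw [hx, integral_const_mul, RCLike.inner_apply, mul_comm]
  rfl

/-- A Hilbert–Schmidt operator `A` is an integral operator, with the kernel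
`∑ (A bᵢ)(x) conj(bᵢ(y))`, an orthogonal series in `L²(ℝ³ × ℝ³)`. -/
theorem hasKernel_of_hsNormSq {ι : Type*} (b : HilbertBasis ι ℂ L2) {A : Op}
    (h : hsNormSq b A < ⊤) : HasKernel A := by
  set t : ι → Lp ℂ 2 (volume : Measure (R3 × R3)) := fun i => tensor (A (b i)) (b i) with ht
  have horth : Pairwise fun i j => ⟪t i, t j⟫_ℂ = 0 := fun i j hij => by
    simp only [ht]
    rw [inner_tensor, b.orthonormal.inner_eq_zero hij.symm, mul_zero]
  have hnorm : ∀ i, ‖t i‖ ^ 2 = ‖A (b i)‖ ^ 2 := fun i => by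
    have h1 : ⟪t i, t i⟫_ℂ = ⟪A (b i), A (b i)⟫_ℂ := by
      simp only [ht]
      rw [inner_tensor, inner_self_eq_norm_sq_to_K (b i), b.orthonormal.norm_eq_one i]
      simp
    rw [inner_self_eq_norm_sq_to_K, inner_self_eq_norm_sq_to_K] at h1
    exact_mod_cast h1
  have hsum : Summable fun i => ‖t i‖ ^ 2 := by
    simp_rw [hnorm]
    have h2 : ∑' i, ENNReal.ofReal (‖A (b i)‖ ^ 2) ≠ ⊤ := by
      simp_rw [ENNReal.ofReal_pow (norm_nonneg _), ofReal_norm]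
      exact h.ne
    have h3 := ENNReal.summable_toReal h2
    simpa [ENNReal.toReal_ofReal] using h3
  have hS : Summable t := by
    have hV : OrthogonalFamily ℂ (fun i => (ℂ ∙ t i : Submodule ℂ _))
        fun i => (ℂ ∙ t i : Submodule ℂ _).subtypeₗᵢ :=
      OrthogonalFamily.of_pairwise fun i j hij => by
        rw [Function.onFun, Submodule.isOrtho_span]
        rintro u rfl v rfl
        exact horth hij
    have := (hV.summable_iff_norm_sq_summable
      (fun i => ⟨t i, Submodule.mem_span_singleton_self _⟩)).2 hsum
    exact this
  set K := ∑' i, t i with hK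
  refine ⟨K, Lp.memLp K, fun f => ?_⟩
  have hkl : (Lp.memLp K).toLp = K := Lp.toLp_coeFn K _
  have key : A f = (memLp_integral_kernel (Lp.memLp K) f).toLp := by
    refine ext_inner_left ℂ fun g => ?_
    rw [← inner_tensor_kernel (Lp.memLp K), hkl]
    have h1 : HasSum (fun i => ⟪tensor g f, t i⟫_ℂ) ⟪tensor g f, K⟫_ℂ :=
      hS.hasSum.mapL (innerSL ℂ (tensor g f))
    have h2 : HasSum (fun i => ⟪tensor g f, t i⟫_ℂ) ⟪g, A f⟫_ℂ := by
      have h3 := ((b.hasSum_repr f).mapL A).mapL (innerSL ℂ g)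
      have e : (fun i => ⟪tensor g f, t i⟫_ℂ) = fun i => innerSL ℂ g (A (b.repr f i • b i)) := by
        funext i
        simp only [ht]
        rw [inner_tensor, mul_comm, ← b.repr_apply_apply, map_smul, map_smul, smul_eq_mul]
        rfl
      rw [e]
      exact h3
    exact h2.unique h1
  rw [key]
  exact (memLp_integral_kernel (Lp.memLp K) f).coeFn_toLp

end Kernels

/-! ### Multiplication operators -/

section Multiplication

variable {χ : R3 → ℝ} (hχ : Continuous χ) (h0 : ∀ x, 0 ≤ χ x) (h1 : ∀ x, χ x ≤ 1)

include hχ h0 h1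

theorem star_mulOp : star (mulOp χ) = mulOp χ := by
  rw [ContinuousLinearMap.star_eq_adjoint]
  symm
  rw [ContinuousLinearMap.eq_adjoint_iff]
  intro f g
  rw [L2.inner_def, L2.inner_def]
  refine integral_congr_ae ?_
  filter_upwards [mulOp_apply_ae hχ h0 h1 f, mulOp_apply_ae hχ h0 h1 g] with x hf hg
  rw [hf, hg]
  simp only [RCLike.inner_apply, map_mul]
  rw [show (starRingEnd ℂ) (χ x : ℂ) = χ x from Complex.conj_ofReal _]
  ring

theorem norm_mulOp_le : ‖mulOp χ‖ ≤ 1 := by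
  refine ContinuousLinearMap.opNorm_le_bound _ zero_le_one fun f => ?_
  rw [one_mul]
  refine Lp.norm_le_norm_of_ae_le ?_
  filter_upwards [mulOp_apply_ae hχ h0 h1 f] with x hf
  rw [hf, norm_mul, Complex.norm_real, Real.norm_of_nonneg (h0 x)]
  exact mul_le_of_le_one_left (norm_nonneg _) (h1 x)

theorem mulOp_mul_self_le_one : mulOp χ * mulOp χ ≤ 1 := by
  have hs := star_mulOp hχ h0 h1
  have hp : 0 ≤ mulOp χ * mulOp χ := by
    have h := star_mul_self_nonneg (mulOp χ)
    rwa [hs] at h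
  rw [← CStarAlgebra.norm_le_one_iff_of_nonneg _ hp]
  exact (norm_mul_le _ _).trans (mul_le_one₀ (norm_mulOp_le hχ h0 h1) (norm_nonneg _)
    (norm_mulOp_le hχ h0 h1))

theorem IsKernel.mulOp_mul_mulOp {A : Op} {k : R3 × R3 → ℂ} (hk : IsKernel A k) :
    IsKernel (mulOp χ * A * mulOp χ) fun z => χ z.1 * k z * χ z.2 := by
  refine ⟨?_, fun f => ?_⟩
  · refine hk.1.mono ?_ (Filter.Eventually.of_forall fun z => ?_)
    · have hm1 : AEStronglyMeasurable (fun z : R3 × R3 => (χ z.1 : ℂ)) volume := by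
        fun_prop
      have hm2 : AEStronglyMeasurable (fun z : R3 × R3 => (χ z.2 : ℂ)) volume := by
        fun_prop
      exact (hm1.mul hk.1.1).mul hm2
    · rw [norm_mul, norm_mul, Complex.norm_real, Complex.norm_real, Real.norm_of_nonneg (h0 _),
        Real.norm_of_nonneg (h0 _)]
      calc χ z.1 * ‖k z‖ * χ z.2 ≤ 1 * ‖k z‖ * 1 := by
            gcongr
            exacts [h0 _, h1 _, h1 _]
        _ = ‖k z‖ := by ring
  · filter_upwards [mulOp_apply_ae hχ h0 h1 (A (mulOp χ f)), hk.2 (mulOp χ f)] with x hx1 hx2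
    rw [mul_apply_eq_comp, mul_apply_eq_comp, hx1, hx2, ← integral_const_mul]
    refine integral_congr_ae ?_
    filter_upwards [mulOp_apply_ae hχ h0 h1 f] with y hy
    rw [hy]
    ring

end Multiplication

/-! ### The Coulomb potential as a superposition of Gaussians -/

section Coulomb

/-- The weight `Γ(1/2)⁻¹ t^{-1/2} (π / 4t)^{-3/2}` in `coulomb_eq_lintegral`: it combines
`1 / r = Γ(1/2)⁻¹ ∫ t^{-1/2} exp (-t r²) dt` over `t > 0` with the normalization of the Gaussian in
`lintegral_gaussian`. -/
def coulombWeight (t : ℝ) : ℝ≥0∞ :=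
  ENNReal.ofReal ((Real.Gamma (1 / 2))⁻¹ * t ^ (-(1 / 2) : ℝ) *
    (Real.pi / (4 * t)) ^ (-(3 / 2) : ℝ))

theorem measurable_coulombWeight : Measurable coulombWeight := by
  unfold coulombWeight
  fun_prop

theorem sq_dist_add_sq_dist (x y z : R3) :
    ‖x - z‖ ^ 2 + ‖y - z‖ ^ 2 = 2 * ‖z - (2⁻¹ : ℝ) • (x + y)‖ ^ 2 + ‖x - y‖ ^ 2 / 2 := by
  have h := parallelogram_law_with_norm ℝ (z - (2⁻¹ : ℝ) • (x + y)) ((2⁻¹ : ℝ) • (x - y))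
  have e1 : z - (2⁻¹ : ℝ) • (x + y) + (2⁻¹ : ℝ) • (x - y) = -(y - z) := by module
  have e2 : z - (2⁻¹ : ℝ) • (x + y) - (2⁻¹ : ℝ) • (x - y) = -(x - z) := by module
  rw [e1, e2, norm_neg, norm_neg, norm_smul, Real.norm_of_nonneg (by norm_num)] at h
  linear_combination h

theorem lintegral_gaussian {t : ℝ} (ht : 0 < t) (m : R3) :
    ∫⁻ z : R3, ENNReal.ofReal (Real.exp (-(4 * t) * ‖z - m‖ ^ 2)) =
      ENNReal.ofReal ((Real.pi / (4 * t)) ^ (3 / 2 : ℝ)) := by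
  have hb : 0 < 4 * t := by positivity
  rw [lintegral_sub_right_eq_self (fun z : R3 => ENNReal.ofReal (Real.exp (-(4 * t) * ‖z‖ ^ 2))) m,
    ← ofReal_integral_eq_lintegral_ofReal, GaussianFourier.integral_rexp_neg_mul_sq_norm hb]
  · simp
  · have := (GaussianFourier.integrable_cexp_neg_mul_sq_norm_add (V := R3) (b := ((4 * t : ℝ) : ℂ))
      (by simpa using hb) 0 0).norm
    refine this.congr (Filter.Eventually.of_forall fun v => ?_)
    simp [Complex.norm_exp, ← Complex.ofReal_pow]
  · exact Filter.Eventually.of_forall fun _ => (Real.exp_pos _).le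

/-- `1 / |x - y|` is a superposition, over `t > 0` and `z ∈ ℝ³`, of products
`exp (-2t|x - z|²) exp (-2t|y - z|²)` of a function of `x` and the same function of `y`. -/
theorem coulomb_eq_lintegral {x y : R3} (hxy : x ≠ y) :
    ‖x - y‖ₑ⁻¹ = ∫⁻ t in Set.Ioi (0 : ℝ), ∫⁻ z : R3, coulombWeight t *
      ENNReal.ofReal (Real.exp (-(2 * t) * ‖x - z‖ ^ 2) * Real.exp (-(2 * t) * ‖y - z‖ ^ 2)) := by
  have hr : 0 < ‖x - y‖ := norm_pos_iff.2 (sub_ne_zero.2 hxy)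
  have hG : 0 < Real.Gamma (1 / 2) := Real.Gamma_pos_of_pos (by norm_num)
  have hin : ∀ t ∈ Set.Ioi (0 : ℝ), ∫⁻ z : R3, coulombWeight t *
      ENNReal.ofReal (Real.exp (-(2 * t) * ‖x - z‖ ^ 2) * Real.exp (-(2 * t) * ‖y - z‖ ^ 2)) =
      ENNReal.ofReal ((Real.Gamma (1 / 2))⁻¹ *
        (t ^ ((1 / 2 : ℝ) - 1) * Real.exp (-(‖x - y‖ ^ 2 * t)))) := by
    intro t ht
    have ht' : 0 < t := ht
    have e : ∀ z : R3, ENNReal.ofReal (Real.exp (-(2 * t) * ‖x - z‖ ^ 2) *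
        Real.exp (-(2 * t) * ‖y - z‖ ^ 2)) = ENNReal.ofReal (Real.exp (-(‖x - y‖ ^ 2 * t))) *
        ENNReal.ofReal (Real.exp (-(4 * t) * ‖z - (2⁻¹ : ℝ) • (x + y)‖ ^ 2)) := by
      intro z
      rw [← ENNReal.ofReal_mul (Real.exp_pos _).le, ← Real.exp_add, ← Real.exp_add]
      congr 2
      linear_combination (-(2 * t)) * sq_dist_add_sq_dist x y z
    simp_rw [e]
    rw [lintegral_const_mul' _ _ (by simp [coulombWeight]),
      lintegral_const_mul' _ _ ENNReal.ofReal_ne_top, lintegral_gaussian ht', coulombWeight,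
      ← ENNReal.ofReal_mul (Real.exp_pos _).le, ← ENNReal.ofReal_mul (by positivity)]
    congr 1
    have hp : 0 < Real.pi / (4 * t) := by positivity
    have : (Real.pi / (4 * t)) ^ (-(3 / 2) : ℝ) * (Real.pi / (4 * t)) ^ (3 / 2 : ℝ) = 1 := by
      rw [← Real.rpow_add hp]; norm_num
    rw [show (1 / 2 : ℝ) - 1 = -(1 / 2) by norm_num]
    linear_combination ((Real.Gamma (1 / 2))⁻¹ * t ^ (-(1 / 2) : ℝ) *
      Real.exp (-(‖x - y‖ ^ 2 * t))) * this
  rw [setLIntegral_congr_fun measurableSet_Ioi hin]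
  have hint := Real.integral_rpow_mul_exp_neg_mul_Ioi (a := 1 / 2) (r := ‖x - y‖ ^ 2)
    (by norm_num) (by positivity)
  have hval : (1 / ‖x - y‖ ^ 2) ^ (1 / 2 : ℝ) = ‖x - y‖⁻¹ := by
    rw [← Real.sqrt_eq_rpow, one_div, Real.sqrt_inv, Real.sqrt_sq hr.le]
  rw [hval] at hint
  have hI : Integrable (fun t : ℝ => t ^ ((1 / 2 : ℝ) - 1) * Real.exp (-(‖x - y‖ ^ 2 * t)))
      (volume.restrict (Set.Ioi 0)) := by
    refine Integrable.of_integral_ne_zero ?_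
    rw [hint]
    positivity
  rw [← ofReal_integral_eq_lintegral_ofReal (hI.const_mul _), integral_const_mul, hint,
    mul_comm, mul_assoc, mul_inv_cancel₀ hG.ne', mul_one, ENNReal.ofReal_inv_of_pos hr, ofReal_norm]
  filter_upwards [ae_restrict_mem measurableSet_Ioi] with t ht
  have ht' : 0 < t := ht
  positivity

theorem ae_fst_ne_snd : ∀ᵐ z : R3 × R3, z.1 ≠ z.2 := by
  have hm : MeasurableSet {z : R3 × R3 | z.1 ≠ z.2} :=
    (measurableSet_eq_fun measurable_fst measurable_snd).compl
  rw [Measure.volume_eq_prod, Measure.ae_prod_iff_ae_ae hm]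
  refine Filter.Eventually.of_forall fun x => ?_
  have : ∀ᵐ y : R3, y ≠ x := by simp [ae_iff]
  filter_upwards [this] with y hy using hy.symm

/-- The Gaussian `exp (-t|x - z|²)` in the variable `x`, with parameters `s = (t, z)`. -/
def gaussian (s : ℝ × R3) (x : R3) : ℝ := Real.exp (-s.1 * ‖x - s.2‖ ^ 2)

theorem continuous_gaussian (s : ℝ × R3) : Continuous (gaussian s) := by
  unfold gaussian
  fun_prop

theorem gaussian_nonneg (s : ℝ × R3) (x : R3) : 0 ≤ gaussian s x := (Real.exp_pos _).le

theorem gaussian_le_one {s : ℝ × R3} (hs : 0 < s.1) (x : R3) : gaussian s x ≤ 1 :=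
  Real.exp_le_one_iff.2 (by
    have : 0 ≤ s.1 * ‖x - s.2‖ ^ 2 := by positivity
    linarith)

theorem ae_fst_pos :
    ∀ᵐ s ∂(volume.restrict (Set.Ioi (0 : ℝ))).prod (volume : Measure R3), 0 < s.1 := by
  have : ∀ᵐ t ∂volume.restrict (Set.Ioi (0 : ℝ)), 0 < t := ae_restrict_mem measurableSet_Ioi
  exact Measure.quasiMeasurePreserving_fst.ae this

/-- The exchange energy is a superposition of squared Hilbert–Schmidt norms of `G A G`, with `G`
the multiplication by a Gaussian. -/
theorem lintegral_kernel_coulomb (b : HilbertBasis ℕ ℂ L2) {A : Op} {k : R3 × R3 → ℂ}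
    (hk : IsKernel A k) : ∫⁻ z : R3 × R3, ‖k z‖ₑ ^ 2 / ‖z.1 - z.2‖ₑ =
      ∫⁻ s, coulombWeight s.1 * hsNormSq b (mulOp (gaussian s) * A * mulOp (gaussian s))
        ∂(volume.restrict (Set.Ioi (0 : ℝ))).prod volume := by
  set ν : Measure (ℝ × R3) := (volume.restrict (Set.Ioi (0 : ℝ))).prod volume with hν
  set F : (R3 × R3) → (ℝ × R3) → ℝ≥0∞ := fun z s => coulombWeight s.1 *
      ENNReal.ofReal (Real.exp (-(2 * s.1) * ‖z.1 - s.2‖ ^ 2) *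
        Real.exp (-(2 * s.1) * ‖z.2 - s.2‖ ^ 2)) with hF
  have hFm : Measurable (Function.uncurry F) := by
    have := measurable_coulombWeight
    simp only [hF]
    unfold Function.uncurry
    fun_prop
  have h1 : ∀ᵐ z : R3 × R3, ‖k z‖ₑ ^ 2 / ‖z.1 - z.2‖ₑ = ∫⁻ s, ‖k z‖ₑ ^ 2 * F z s ∂ν := by
    filter_upwards [ae_fst_ne_snd] with z hz
    have hm : Measurable (F z) := hFm.of_uncurry_left
    rw [lintegral_const_mul _ hm, div_eq_mul_inv, coulomb_eq_lintegral hz, hν,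
      lintegral_prod _ hm.aemeasurable]
  have hkm : AEMeasurable (fun z => ‖k z‖ₑ ^ 2) volume := hk.1.1.enorm.pow_const 2
  rw [lintegral_congr_ae h1, lintegral_lintegral_swap (hkm.comp_fst.mul hFm.aemeasurable), hν]
  refine lintegral_congr_ae ?_
  filter_upwards [ae_fst_pos] with s hs
  rw [← lintegral_kernel_sq b (hk.mulOp_mul_mulOp (continuous_gaussian s)
    (gaussian_nonneg s) (gaussian_le_one hs)), ← lintegral_const_mul' _ _
    (by simp [coulombWeight])]
  refine lintegral_congr fun z => ?_
  have hsq : ∀ x, ENNReal.ofReal (Real.exp (-(2 * s.1) * ‖x - s.2‖ ^ 2)) =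
      ‖(gaussian s x : ℂ)‖ₑ ^ 2 := fun x => by
    rw [← ofReal_norm, Complex.norm_real, Real.norm_of_nonneg (gaussian_nonneg s x),
      ← ENNReal.ofReal_pow (gaussian_nonneg s x), gaussian, ← Real.exp_nat_mul]
    congr 2
    push_cast
    ring
  simp only [hF]
  rw [ENNReal.ofReal_mul (Real.exp_pos _).le, hsq, hsq, enorm_mul, enorm_mul]
  ring

/-- The exchange energy is monotone on positive operators. -/
theorem lintegral_kernel_coulomb_mono (b : HilbertBasis ℕ ℂ L2) {A B : Op}
    {k l : R3 × R3 → ℂ} (hk : IsKernel A k) (hl : IsKernel B l) (hA : 0 ≤ A) (hAB : A ≤ B) :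
    ∫⁻ z : R3 × R3, ‖k z‖ₑ ^ 2 / ‖z.1 - z.2‖ₑ ≤ ∫⁻ z : R3 × R3, ‖l z‖ₑ ^ 2 / ‖z.1 - z.2‖ₑ := by
  rw [lintegral_kernel_coulomb b hk, lintegral_kernel_coulomb b hl]
  refine lintegral_mono_ae ?_
  filter_upwards [ae_fst_pos] with s hs
  have hG : IsSelfAdjoint (mulOp (gaussian s)) :=
    star_mulOp (continuous_gaussian s) (gaussian_nonneg s) (gaussian_le_one hs)
  gcongr
  exact hsNormSq_le_of_le b (hG.conjugate_nonneg hA) (hG.conjugate_le_conjugate hAB)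

theorem IsKernel.exchange_eq (b : HilbertBasis ℕ ℂ L2) {A : Op} {k : R3 × R3 → ℂ}
    (hk : IsKernel A k) :
    exchange A = 2⁻¹ * ∫⁻ z : R3 × R3, ‖k z‖ₑ ^ 2 / ‖z.1 - z.2‖ₑ := by
  have h : HasKernel A := ⟨k, hk⟩
  have hker : IsKernel A (kernel A) := by
    rw [kernel, dif_pos h]
    exact h.choose_spec
  rw [exchange]
  congr 1
  refine lintegral_congr_ae ?_
  filter_upwards [hker.ae_eq b hk] with z hz
  rw [hz]

theorem exchange_mono (b : HilbertBasis ℕ ℂ L2) {A B : Op} (hkA : HasKernel A)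
    (hkB : HasKernel B) (hA : 0 ≤ A) (hAB : A ≤ B) : exchange A ≤ exchange B := by
  obtain ⟨k, hk⟩ := hkA
  obtain ⟨l, hl⟩ := hkB
  rw [hk.exchange_eq b, hl.exchange_eq b]
  gcongr 2⁻¹ * ?_
  exact lintegral_kernel_coulomb_mono b hk hl hA hAB

end Coulomb

/-! ### Spectral decompositions -/

section Spectral

variable {ι H : Type*} [NormedAddCommGroup H] [InnerProductSpace ℂ H] [CompleteSpace H]

theorem enorm_apply_sq_le_hsNormSq (b : HilbertBasis ι ℂ H) (A : H →L[ℂ] H) (x : H) :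
    ‖A x‖ₑ ^ 2 ≤ hsNormSq b A * ‖x‖ₑ ^ 2 := by
  rw [← tsum_enorm_inner_sq b, ← hsNormSq_star b b, hsNormSq, ← ENNReal.tsum_mul_right]
  refine ENNReal.tsum_le_tsum fun i => ?_
  rw [← ContinuousLinearMap.adjoint_inner_left, ← ContinuousLinearMap.star_eq_adjoint, ← mul_pow]
  gcongr
  rw [← ofReal_norm, ← ofReal_norm, ← ofReal_norm, ← ENNReal.ofReal_mul (norm_nonneg _)]
  exact ENNReal.ofReal_le_ofReal (norm_inner_le_norm _ _)

/-- A Hilbert–Schmidt operator is compact: it is the norm limit of its restrictions to the spans of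
finitely many basis vectors. -/
theorem isCompactOperator_of_hsNormSq (b : HilbertBasis ι ℂ H) {A : H →L[ℂ] H}
    (h : hsNormSq b A < ⊤) : IsCompactOperator A := by
  classical
  set F : Finset ι → H →L[ℂ] H := fun s => ∑ i ∈ s, (innerSL ℂ (b i)).smulRight (A (b i)) with hF
  have hFb : ∀ s j, F s (b j) = if j ∈ s then A (b j) else 0 := by
    intro s j
    simp only [hF, sum_apply, ContinuousLinearMap.smulRight_apply,
      innerSL_apply_apply]
    rw [← Finset.sum_ite_eq s j fun i => A (b i)]
    refine Finset.sum_congr rfl fun i _ => ?_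
    rw [orthonormal_iff_ite.1 b.orthonormal i j]
    split_ifs with h1 h2 h2
    · simp
    · exact absurd h1.symm h2
    · exact absurd h2.symm h1
    · simp
  have hFc : ∀ s, IsCompactOperator (F s) := by
    intro s
    simp only [hF]
    induction s using Finset.induction_on with
    | empty => simpa using isCompactOperator_zero
    | insert i s hi ih =>
      rw [Finset.sum_insert hi]
      refine IsCompactOperator.add ?_ ih
      exact (isCompactOperator_of_locallyCompactSpace_dom (innerSL ℂ (b i))).clm_comp
        ((ContinuousLinearMap.id ℂ ℂ).smulRight (A (b i)))
  have htail : ∀ s : Finset ι, hsNormSq b (A - F s) = ∑' i : {i // i ∉ s}, ‖A (b i)‖ₑ ^ 2 := by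
    intro s
    refine Eq.trans ?_ (tsum_subtype {i | i ∉ s} fun i => ‖A (b i)‖ₑ ^ 2).symm
    refine tsum_congr fun i => ?_
    rw [sub_apply, hFb]
    by_cases hi : i ∈ s <;> simp [hi]
  have hlim := ENNReal.tendsto_tsum_compl_atTop_zero (f := fun i => ‖A (b i)‖ₑ ^ 2) h.ne
  simp_rw [← htail] at hlim
  refine isCompactOperator_of_tendsto (F := F) (l := Filter.atTop) ?_
    (Filter.Eventually.of_forall hFc)
  rw [tendsto_iff_norm_sub_tendsto_zero]
  have hroot : Filter.Tendsto (fun s => Real.sqrt (hsNormSq b (A - F s)).toReal) Filter.atTop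
      (nhds 0) := by
    have := (Real.continuous_sqrt.tendsto 0).comp
      ((ENNReal.tendsto_toReal ENNReal.zero_ne_top).comp hlim)
    rwa [Real.sqrt_zero] at this
  refine squeeze_zero' (Filter.Eventually.of_forall fun s => norm_nonneg _) ?_ hroot
  filter_upwards [hlim.eventually_lt_const ENNReal.zero_lt_top] with s hs
  rw [norm_sub_rev]
  refine ContinuousLinearMap.opNorm_le_bound _ (Real.sqrt_nonneg _) fun x => ?_
  have h1 := enorm_apply_sq_le_hsNormSq b (A - F s) x
  have h2 := ENNReal.toReal_mono (ENNReal.mul_ne_top hs.ne (by simp)) h1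
  rw [ENNReal.toReal_mul, ENNReal.toReal_pow, ENNReal.toReal_pow, toReal_enorm, toReal_enorm] at h2
  refine le_of_sq_le_sq ?_ (by positivity)
  rwa [mul_pow, Real.sq_sqrt ENNReal.toReal_nonneg]

omit [CompleteSpace H] in
theorem countable_of_orthonormal [TopologicalSpace.SeparableSpace H] {v : ι → H}
    (hv : Orthonormal ℂ v) : Countable ι := by
  have hd : Pairwise (Function.onFun Disjoint fun i => Metric.ball (v i) (1 / 2)) := by
    intro i j hij
    refine Metric.ball_disjoint_ball ?_
    have h1 : ‖v i - v j‖ ^ 2 = 2 := by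
      rw [@norm_sub_sq ℂ, hv.inner_eq_zero hij, hv.norm_eq_one, hv.norm_eq_one]
      norm_num
    rw [dist_eq_norm]
    nlinarith [norm_nonneg (v i - v j)]
  exact hd.countable_of_isOpen_disjoint (fun _ => Metric.isOpen_ball)
    fun i => ⟨v i, Metric.mem_ball_self (by norm_num)⟩

/-- The spectral theorem for compact self-adjoint operators on a separable, infinite-dimensional
Hilbert space, with the eigenvectors enumerated by `ℕ`. -/
theorem exists_hilbertBasis_eigenvectors [TopologicalSpace.SeparableSpace H]
    (hdim : ¬ FiniteDimensional ℂ H) {T : H →L[ℂ] H} (hT : IsCompactOperator T)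
    (hs : IsSelfAdjoint T) :
    ∃ (u : HilbertBasis ℕ ℂ H) (l : ℕ → ℝ), ∀ i, T (u i) = (l i : ℂ) • u i := by
  have hsym : (T : H →ₗ[ℂ] H).IsSymmetric := hs.isSymmetric
  let E : ℂ → Submodule ℂ H := fun μ => Module.End.eigenspace (T : Module.End ℂ H) μ
  have hcl : ∀ μ, IsClosed (E μ : Set H) := fun μ => by
    have : (E μ : Set H) = {x | T x = μ • x} := by
      ext x
      simp [E]
    rw [this]
    exact isClosed_eq T.continuous (continuous_const_smul μ)
  have hcomp : ∀ μ, CompleteSpace (E μ) := fun μ => (hcl μ).completeSpace_coe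
  choose w b hb using fun μ => exists_hilbertBasis ℂ (E μ)
  let I := Σ μ, w μ
  let v : I → H := fun a => (b a.1 a.2 : H)
  have hv : Orthonormal ℂ v :=
    hsym.orthogonalFamily_eigenspaces.orthonormal_sigma_orthonormal fun μ => (b μ).orthonormal
  have hbot : (Submodule.span ℂ (Set.range v))ᗮ = ⊥ := by
    rw [Submodule.eq_bot_iff]
    intro x hx
    have hx' : ∀ a, ⟪v a, x⟫_ℂ = 0 := fun a =>
      (Submodule.mem_orthogonal _ _).1 hx _ (Submodule.subset_span ⟨a, rfl⟩)
    have h1 : x ∈ (⨆ μ, E μ)ᗮ := by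
      rw [← Submodule.iInf_orthogonal, Submodule.mem_iInf]
      intro μ
      rw [Submodule.mem_orthogonal]
      intro y hy
      have h2 : HasSum (fun i => ⟪((b μ).repr ⟨y, hy⟩ i • b μ i : E μ).1, x⟫_ℂ) ⟪y, x⟫_ℂ := by
        have h3 := ((b μ).hasSum_repr ⟨y, hy⟩).mapL (E μ).subtypeL
        have h4 := h3.mapL (innerSL ℂ x)
        have h5 := h4.star
        simpa [← starRingEnd_apply, inner_conj_symm, inner_smul_left, mul_comm] using h5
      refine h2.unique ?_
      have h6 : ∀ i, ⟪((b μ).repr ⟨y, hy⟩ i • b μ i : E μ).1, x⟫_ℂ = 0 := fun i => by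
        have := hx' ⟨μ, i⟩
        simp only [v] at this
        rw [Submodule.coe_smul, inner_smul_left, this, mul_zero]
      simp_rw [h6]
      exact hasSum_zero
    rw [ContinuousLinearMap.orthogonalComplement_iSup_eigenspaces_eq_bot hT hsym] at h1
    simpa using h1
  have hcount : Countable I := countable_of_orthonormal hv
  have hinf : Infinite I := by
    by_contra hfin
    rw [not_infinite_iff_finite] at hfin
    apply hdim
    have htop : Submodule.span ℂ (Set.range v) = ⊤ := by
      have : FiniteDimensional ℂ (Submodule.span ℂ (Set.range v)) :=
        FiniteDimensional.span_of_finite ℂ (Set.finite_range v)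
      exact Submodule.orthogonal_eq_bot_iff.1 hbot
    exact ⟨htop ▸ Submodule.fg_span (Set.finite_range v)⟩
  obtain ⟨e⟩ : Nonempty (ℕ ≃ I) := by
    have := (nonempty_denumerable_iff (α := I)).2 ⟨hcount, hinf⟩
    exact this.map fun d => (@Denumerable.eqv I d).symm
  have hu : Orthonormal ℂ (v ∘ e) := hv.comp e e.injective
  let u : HilbertBasis ℕ ℂ H := HilbertBasis.mkOfOrthogonalEqBot hu (by
    rw [Set.range_comp, e.surjective.range_eq, Set.image_univ]
    exact hbot)
  have hu' : ∀ i, u i = v (e i) := fun i => by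
    simp only [u, HilbertBasis.coe_mkOfOrthogonalEqBot, Function.comp]
  refine ⟨u, fun i => (e i).1.re, fun i => ?_⟩
  have hmem : v (e i) ∈ E (e i).1 := (b (e i).1 (e i).2).2
  have heig : Module.End.HasEigenvector (T : Module.End ℂ H) (e i).1 (v (e i)) :=
    ⟨hmem, hv.ne_zero _⟩
  have hreal := hsym.conj_eigenvalue_eq_self (Module.End.hasEigenvalue_of_hasEigenvector heig)
  rw [hu', Complex.conj_eq_iff_re.1 hreal]
  exact Module.End.mem_eigenspace_iff.1 hmem

/-- The square root of a positive operator has the same eigenvectors. -/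
theorem sqrtOp_apply_eigenvector {A : H →L[ℂ] H} (hA : 0 ≤ A) {l : ℝ} (hl : 0 ≤ l) {u : H}
    (hu : A u = (l : ℂ) • u) : sqrtOp A u = (Real.sqrt l : ℂ) • u := by
  have hp : (sqrtOp A).IsPositive :=
    ContinuousLinearMap.nonneg_iff_isPositive _ |>.1 (CFC.sqrt_nonneg A)
  set s := sqrtOp A with hs
  have hss : ∀ x, s (s x) = A x := fun x => by
    rw [← mul_apply_eq_comp, hs, sqrtOp_mul_self hA]
  have hsl : (Real.sqrt l : ℂ) * Real.sqrt l = l := by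
    rw [← Complex.ofReal_mul, Real.mul_self_sqrt hl]
  -- `w = (s - √l) u` is annihilated by `s + √l`.
  set w := s u - (Real.sqrt l : ℂ) • u with hw
  have h1 : s w = -((Real.sqrt l : ℂ) • w) := by
    rw [hw, map_sub, map_smul, hss, hu, smul_sub, smul_smul, hsl]
    abel
  have h2 := hp.re_inner_nonneg_right w
  rw [h1, inner_neg_right, inner_smul_right, inner_self_eq_norm_sq_to_K] at h2
  have h3 : Real.sqrt l * ‖w‖ ^ 2 ≤ 0 := by
    have : RCLike.re (-((Real.sqrt l : ℂ) * ((‖w‖ : ℂ)) ^ 2)) = -(Real.sqrt l * ‖w‖ ^ 2) := by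
      rw [← Complex.ofReal_pow, ← Complex.ofReal_mul, ← Complex.ofReal_neg]
      rfl
    have h2' := this ▸ h2
    linarith
  rcases (Real.sqrt_nonneg l).eq_or_lt with h0 | h0
  · have hl0 : l = 0 := by rwa [eq_comm, Real.sqrt_eq_zero hl] at h0
    have h4 : ⟪s u, s u⟫_ℂ = 0 := by
      have := hp.isSelfAdjoint.isSymmetric u (s u)
      simp only [ContinuousLinearMap.coe_coe] at this
      rw [this, hss, hu, hl0]
      simp
    rw [inner_self_eq_zero.1 h4, hl0]
    simp
  · have : ‖w‖ ^ 2 ≤ 0 := by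
      by_contra hc
      push Not at hc
      nlinarith [mul_pos h0 hc]
    have h5 : w = 0 := norm_eq_zero.1 (by nlinarith [norm_nonneg w])
    exact sub_eq_zero.1 h5

end Spectral

section Density

/-- The indicator functions of disjoint balls are linearly independent in `L²(ℝ³)`. -/
theorem not_finiteDimensional_L2 : ¬ FiniteDimensional ℂ L2 := by
  intro hfin
  let c : ℕ → R3 := fun n => EuclideanSpace.single 0 (n : ℝ)
  have hc : ∀ {m n : ℕ}, m ≠ n → 1 ≤ dist (c m) (c n) := by
    intro m n hmn
    simp only [c]
    rw [PiLp.dist_single_same, Nat.dist_cast_real]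
    exact Nat.pairwise_one_le_dist hmn
  let B : ℕ → Set R3 := fun n => Metric.ball (c n) (1 / 2)
  have hm : ∀ n, MeasurableSet (B n) := fun n => measurableSet_ball
  have hf : ∀ n, volume (B n) ≠ ⊤ := fun n => measure_ball_lt_top.ne
  let f : ℕ → L2 := fun n => indicatorConstLp 2 (hm n) (hf n) (1 : ℂ)
  have hin : ∀ m n, ⟪f m, f n⟫_ℂ = ((volume : Measure R3).real (B m ∩ B n) : ℂ) := fun m n =>
    L2.inner_indicatorConstLp_one_indicatorConstLp_one (hm m) (hm n) (hf m) (hf n)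
  have hlin : LinearIndependent ℂ f := by
    refine linearIndependent_of_ne_zero_of_inner_eq_zero (fun n hn => ?_) fun m n hmn => ?_
    · have h := hin n n
      rw [hn, inner_zero_left, Set.inter_self] at h
      have hpos : 0 < (volume : Measure R3).real (B n) :=
        ENNReal.toReal_pos (Metric.measure_ball_pos _ _ (by norm_num)).ne' (hf n)
      exact hpos.ne' (by exact_mod_cast h.symm)
    · have hd : Disjoint (B m) (B n) := Metric.ball_disjoint_ball (by
        have := hc hmn
        linarith)
      change ⟪f m, f n⟫_ℂ = 0
      rw [hin, hd.inter_eq]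
      simp
  exact not_finite_iff_infinite.2 inferInstance hlin.finite

theorem IsDensityMatrix.hsNormSq_sqrtOp_lt_top {ι : Type*} {γ : Op} (hγ : IsDensityMatrix γ)
    (b : HilbertBasis ι ℂ L2) : hsNormSq b (sqrtOp γ) < ⊤ :=
  DensityMatrix.hsNormSq_sqrtOp_lt_top b hγ.nonneg hγ.traceClass

theorem IsDensityMatrix.exists_isSpectralDecomposition {γ : Op} (hγ : IsDensityMatrix γ) :
    ∃ u : HilbertBasis ℕ ℂ L2, ∃ l : ℕ → ℝ, IsSpectralDecomposition γ u l := by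
  obtain ⟨w, b, -⟩ := exists_hilbertBasis ℂ L2
  have hc : IsCompactOperator (sqrtOp γ : L2 → L2) :=
    isCompactOperator_of_hsNormSq b (hγ.hsNormSq_sqrtOp_lt_top b)
  have hc' : IsCompactOperator (γ : L2 → L2) := by
    have := hc.clm_comp (sqrtOp γ)
    rwa [← ContinuousLinearMap.coe_comp, ← ContinuousLinearMap.mul_def,
      sqrtOp_mul_self hγ.nonneg] at this
  have : Fact ((2 : ℝ≥0∞) ≠ ⊤) := ⟨by norm_num⟩
  exact exists_hilbertBasis_eigenvectors not_finiteDimensional_L2 hc' hγ.nonneg.isSelfAdjoint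

/-- `∫ χ² ρ_γ` is the squared Hilbert–Schmidt norm of `χ γ^{1/2}`. -/
theorem IsDensityMatrix.lintegral_density {γ : Op} (hγ : IsDensityMatrix γ) {χ : R3 → ℝ}
    (hχ : Continuous χ) (h0 : ∀ x, 0 ≤ χ x) (h1 : ∀ x, χ x ≤ 1) (b : HilbertBasis ℕ ℂ L2) :
    ∫⁻ x, ENNReal.ofReal (χ x ^ 2) * density γ x = hsNormSq b (mulOp χ * sqrtOp γ) := by
  have h := hγ.exists_isSpectralDecomposition
  have hd : ∀ x, density γ x = ∑' i, ENNReal.ofReal (h.choose_spec.choose i) *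
      ‖(h.choose i : L2) x‖ₑ ^ 2 := fun x => by rw [density, dif_pos h]
  have hspec := h.choose_spec.choose_spec
  set u := h.choose
  set l := h.choose_spec.choose
  have hl : ∀ i, 0 ≤ l i := fun i => by
    have hp := (ContinuousLinearMap.nonneg_iff_isPositive _ |>.1 hγ.nonneg).re_inner_nonneg_right
      (u i)
    rw [hspec i, inner_smul_right, inner_self_eq_norm_sq_to_K, u.orthonormal.norm_eq_one] at hp
    simpa using hp
  rw [hsNormSq_eq b u, hsNormSq]
  simp_rw [hd, ← ENNReal.tsum_mul_left]
  rw [lintegral_tsum fun i => by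
    have : AEMeasurable (fun x => ‖u i x‖ₑ ^ 2) (volume : Measure R3) :=
      (Lp.aestronglyMeasurable (u i)).enorm.pow_const 2
    have hχm := hχ.measurable
    exact AEMeasurable.mul (by fun_prop) (this.const_mul _)]
  refine tsum_congr fun i => ?_
  rw [mul_apply_eq_comp, sqrtOp_apply_eigenvector hγ.nonneg (hl i) (hspec i), map_smul, enorm_smul,
    mul_pow, Lp_enorm_sq, ← lintegral_const_mul' _ _ (by simp)]
  refine lintegral_congr_ae ?_
  filter_upwards [mulOp_apply_ae hχ h0 h1 (u i)] with x hx
  have e1 : ‖(Real.sqrt (l i) : ℂ)‖ₑ ^ 2 = ENNReal.ofReal (l i) := by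
    rw [← ofReal_norm, Complex.norm_real, Real.norm_of_nonneg (Real.sqrt_nonneg _),
      ← ENNReal.ofReal_pow (Real.sqrt_nonneg _), Real.sq_sqrt (hl i)]
  have e2 : ‖(χ x : ℂ)‖ₑ ^ 2 = ENNReal.ofReal (χ x ^ 2) := by
    rw [← ofReal_norm, Complex.norm_real, Real.norm_of_nonneg (h0 x), ENNReal.ofReal_pow (h0 x)]
  rw [hx, enorm_mul, mul_pow, e1, e2]
  ring

end Density

/-! ### Translations, Fourier multipliers and the kinetic energy -/

section Fourier

/-- The operator of multiplication by an essentially bounded function `m` on `L²(ℝ³)`. -/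
def multiplier (m : R3 → ℂ) (hm : MemLp m ⊤ (volume : Measure R3)) : Op :=
  (ContinuousLinearMap.mul ℂ ℂ).holderL volume ⊤ 2 2 hm.toLp

theorem multiplier_apply_ae {m : R3 → ℂ} (hm : MemLp m ⊤ (volume : Measure R3)) (f : L2) :
    multiplier m hm f =ᵐ[volume] fun x => m x * f x := by
  filter_upwards [(ContinuousLinearMap.mul ℂ ℂ).coeFn_holder (r := 2) hm.toLp f,
    hm.coeFn_toLp] with x hx hx'
  rw [multiplier, ContinuousLinearMap.holderL_apply_apply, hx, hx']
  rfl

/-- The translation `f ↦ f(· - a)` on `L²(ℝ³)`. -/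
def translation (a : R3) : Op :=
  (Lp.compMeasurePreservingₗᵢ ℂ (fun x : R3 => x - a)
    (measurePreserving_sub_right volume a)).toContinuousLinearMap

theorem translation_apply_ae (a : R3) (f : L2) :
    translation a f =ᵐ[volume] fun x => f (x - a) :=
  Lp.coeFn_compMeasurePreserving f (measurePreserving_sub_right volume a)

/-- The Fourier transform as a bounded operator on `L²(ℝ³)`. -/
def fourierOp : Op :=
  (Lp.fourierTransformₗᵢ R3 ℂ).toLinearIsometry.toContinuousLinearMap

theorem fourierOp_apply (f : L2) : fourierOp f = 𝓕 f := rfl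

/-- The phase by which a translation acts in Fourier space. -/
def phase (a ξ : R3) : ℂ := Complex.exp (Complex.I * (-(2 * Real.pi * ⟪a, ξ⟫_ℝ) : ℝ))

theorem memLp_phase (a : R3) : MemLp (phase a) ⊤ (volume : Measure R3) := by
  have hc : Continuous (phase a) := by unfold phase; fun_prop
  refine memLp_top_of_bound hc.aestronglyMeasurable 1 (Filter.Eventually.of_forall fun ξ => ?_)
  rw [phase, mul_comm, Complex.norm_exp_ofReal_mul_I]

theorem fourierOp_mul_translation (a : R3) :
    fourierOp * translation a = multiplier (phase a) (memLp_phase a) * fourierOp := by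
  have hd : DenseRange (fun g : 𝓢(R3, ℂ) => (g.toLp 2 : L2)) :=
    SchwartzMap.denseRange_toLpCLM (E := R3) (F := ℂ) (μ := volume) (p := 2) ENNReal.ofNat_ne_top
  refine ContinuousLinearMap.coeFn_injective
    (hd.equalizer (ContinuousLinearMap.continuous _) (ContinuousLinearMap.continuous _) ?_)
  funext g
  simp only [Function.comp_apply, mul_apply_eq_comp, fourierOp_apply]
  have h1 : translation a (g.toLp 2) = (g.compSubConstCLM ℂ a).toLp 2 := by
    refine Lp.ext ?_
    filter_upwards [translation_apply_ae a (g.toLp 2),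
      (g.compSubConstCLM ℂ a).coeFn_toLp 2 volume,
      (measurePreserving_sub_right volume a).quasiMeasurePreserving.ae (g.coeFn_toLp 2 volume)]
      with x hx hx' hx''
    rw [hx, hx', hx'']
    rfl
  rw [h1, SchwartzMap.toLp_fourier_eq, SchwartzMap.toLp_fourier_eq]
  refine Lp.ext ?_
  filter_upwards [multiplier_apply_ae (memLp_phase a) ((𝓕 g).toLp 2),
    (𝓕 (g.compSubConstCLM ℂ a)).coeFn_toLp 2 volume, (𝓕 g).coeFn_toLp 2 volume] with ξ h2 h3 h4
  rw [h2, h3, h4, SchwartzMap.fourier_coe, SchwartzMap.fourier_coe]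
  have h5 := congrFun (VectorFourier.fourierIntegral_comp_add_right Real.fourierChar
    (volume : Measure R3) (innerₗ R3) (g : R3 → ℂ) (-a)) ξ
  have h6 : (g.compSubConstCLM ℂ a : R3 → ℂ) = (g : R3 → ℂ) ∘ fun v => v + -a := by
    funext v
    simp [SchwartzMap.compSubConstCLM_apply, sub_eq_add_neg]
  rw [h6]
  refine h5.trans ?_
  rw [Circle.smul_def, Real.fourierChar_apply, smul_eq_mul, phase]
  congr 2
  simp
  ring

/-- `‖f(· - a) - f‖² ≤ ∫ (2π a·ξ)² |(𝓕 f)(ξ)|² dξ`. -/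
theorem enorm_translation_sub_sq_le (a : R3) (f : L2) :
    ‖translation a f - f‖ₑ ^ 2 ≤
      ∫⁻ ξ : R3, ENNReal.ofReal ((2 * Real.pi * ⟪a, ξ⟫_ℝ) ^ 2) * ‖(𝓕 f : L2) ξ‖ₑ ^ 2 := by
  have h1 : ‖translation a f - f‖ₑ = ‖fourierOp (translation a f - f)‖ₑ := by
    rw [← ofReal_norm, ← ofReal_norm, fourierOp_apply, Lp.norm_fourier_eq]
  rw [h1, map_sub, ← mul_apply_eq_comp, fourierOp_mul_translation, Lp_enorm_sq]
  refine lintegral_mono_ae ?_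
  filter_upwards [Lp.coeFn_sub ((multiplier (phase a) (memLp_phase a) * fourierOp) f)
    (fourierOp f), multiplier_apply_ae (memLp_phase a) (fourierOp f)] with ξ h2 h3
  rw [h2, Pi.sub_apply, mul_apply_eq_comp, h3, fourierOp_apply, ← sub_one_mul, enorm_mul, mul_pow]
  gcongr
  rw [← ofReal_norm, ← ENNReal.ofReal_pow (norm_nonneg _)]
  refine ENNReal.ofReal_le_ofReal ?_
  have h4 := Real.norm_exp_I_mul_ofReal_sub_one_le (x := -(2 * Real.pi * ⟪a, ξ⟫_ℝ))
  calc ‖phase a ξ - 1‖ ^ 2 ≤ ‖-(2 * Real.pi * ⟪a, ξ⟫_ℝ)‖ ^ 2 := by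
        gcongr
        exact h4
    _ = _ := by rw [norm_neg, Real.norm_eq_abs, sq_abs]

/-- The three difference quotients of `f` are controlled by the kinetic energy. -/
theorem sum_enorm_translation_sub_sq_le (h : ℝ) (f : L2) :
    ∑ j : Fin 3, ‖translation (EuclideanSpace.single j h) f - f‖ₑ ^ 2 ≤
      ENNReal.ofReal (h ^ 2) * kineticForm f := by
  refine (Finset.sum_le_sum fun j _ => enorm_translation_sub_sq_le _ f).trans ?_
  have hm : AEMeasurable (fun ξ => ‖(𝓕 f : L2) ξ‖ₑ ^ 2) (volume : Measure R3) :=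
    (Lp.aestronglyMeasurable _).enorm.pow_const 2
  have hmj : ∀ j ∈ (Finset.univ : Finset (Fin 3)), AEMeasurable (fun ξ : R3 =>
      ENNReal.ofReal ((2 * Real.pi * ⟪(EuclideanSpace.single j h : R3), ξ⟫_ℝ) ^ 2) *
        ‖(𝓕 f : L2) ξ‖ₑ ^ 2) volume := fun j _ => AEMeasurable.mul (by fun_prop) hm
  rw [← lintegral_finsetSum' _ hmj, kineticForm,
    ← lintegral_const_mul' _ _ ENNReal.ofReal_ne_top]
  refine le_of_eq (lintegral_congr fun ξ => ?_)
  rw [← Finset.sum_mul, ← mul_assoc, ← ENNReal.ofReal_mul (sq_nonneg h),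
    ← ENNReal.ofReal_sum_of_nonneg fun j _ => sq_nonneg _]
  congr 2
  rw [mul_pow _ ‖ξ‖, EuclideanSpace.norm_sq_eq, Finset.mul_sum, Finset.mul_sum]
  refine Finset.sum_congr rfl fun j _ => ?_
  rw [EuclideanSpace.inner_single_left, Real.norm_eq_abs, sq_abs]
  simp
  ring

/-- The Fourier multiplier `2π|ξ|`, cut off at `|ξ| ≤ n`. -/
def cutoff (n : ℕ) (ξ : R3) : ℂ :=
  (Metric.closedBall (0 : R3) n).indicator (fun ξ => ((2 * Real.pi * ‖ξ‖ : ℝ) : ℂ)) ξ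

theorem memLp_cutoff (n : ℕ) : MemLp (cutoff n) ⊤ (volume : Measure R3) := by
  classical
  have hm : Measurable (cutoff n) := by
    unfold cutoff
    exact Measurable.indicator (by fun_prop) measurableSet_closedBall
  refine memLp_top_of_bound hm.aestronglyMeasurable (2 * Real.pi * n)
    (Filter.Eventually.of_forall fun ξ => ?_)
  have hpos : 0 ≤ 2 * Real.pi * n := by positivity
  rw [cutoff, Set.indicator_apply]
  split_ifs with h
  · have hξ : ‖ξ‖ ≤ n := by simpa using h
    rw [Complex.norm_real, Real.norm_of_nonneg (by positivity)]
    gcongr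
  · simpa using hpos

/-- `2π|ξ| 1_{|ξ| ≤ n} 𝓕`, a bounded approximation of the square root of `-Δ`. -/
def kineticCutoff (n : ℕ) : Op := multiplier (cutoff n) (memLp_cutoff n) * fourierOp

theorem enorm_kineticCutoff_sq (n : ℕ) (f : L2) :
    ‖kineticCutoff n f‖ₑ ^ 2 = ∫⁻ ξ : R3, (Metric.closedBall (0 : R3) n).indicator
      (fun ξ => ENNReal.ofReal ((2 * Real.pi * ‖ξ‖) ^ 2) * ‖(𝓕 f : L2) ξ‖ₑ ^ 2) ξ := by
  classical
  rw [Lp_enorm_sq]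
  refine lintegral_congr_ae ?_
  filter_upwards [multiplier_apply_ae (memLp_cutoff n) (fourierOp f)] with ξ hξ
  rw [kineticCutoff, mul_apply_eq_comp, hξ, fourierOp_apply, cutoff, Set.indicator_apply,
    Set.indicator_apply]
  split_ifs with h
  · rw [enorm_mul, mul_pow, ← ofReal_norm (_ : ℂ), Complex.norm_real,
      Real.norm_of_nonneg (by positivity), ← ENNReal.ofReal_pow (by positivity)]
  · simp

theorem enorm_kineticCutoff_sq_le (n : ℕ) (f : L2) : ‖kineticCutoff n f‖ₑ ^ 2 ≤ kineticForm f := by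
  rw [enorm_kineticCutoff_sq]
  exact lintegral_mono fun ξ => Set.indicator_le_self _ _ ξ

theorem tendsto_enorm_kineticCutoff_sq (f : L2) :
    Filter.Tendsto (fun n => ‖kineticCutoff n f‖ₑ ^ 2) Filter.atTop (nhds (kineticForm f)) := by
  simp_rw [enorm_kineticCutoff_sq]
  have hm : AEMeasurable (fun ξ : R3 => ENNReal.ofReal ((2 * Real.pi * ‖ξ‖) ^ 2) *
      ‖(𝓕 f : L2) ξ‖ₑ ^ 2) volume :=
    AEMeasurable.mul (by fun_prop) ((Lp.aestronglyMeasurable _).enorm.pow_const 2)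
  refine lintegral_tendsto_of_tendsto_of_monotone
    (fun n => hm.indicator measurableSet_closedBall) ?_ ?_
  · refine Filter.Eventually.of_forall fun ξ m n hmn => ?_
    exact Set.indicator_le_indicator_of_subset
      (Metric.closedBall_subset_closedBall (by exact_mod_cast hmn)) (fun _ => zero_le) ξ
  · refine Filter.Eventually.of_forall fun ξ => ?_
    refine tendsto_const_nhds.congr' ?_
    filter_upwards [Filter.eventually_ge_atTop ⌈‖ξ‖⌉₊] with n hn
    rw [Set.indicator_of_mem]
    simpa using Nat.ceil_le.1 hn

/-- `A A* ≤ B B*` implies `tr (A* (-Δ) A) ≤ tr (B* (-Δ) B)`. This is `hsNormSq_mul_le` with the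
unbounded `M = (-Δ)^{1/2}`, which the bounded operators `kineticCutoff n` approximate. -/
theorem tsum_kineticForm_le {ι : Type*} (b : HilbertBasis ι ℂ L2) {A B : Op}
    (h : A * star A ≤ B * star B) :
    ∑' i, kineticForm (A (b i)) ≤ ∑' i, kineticForm (B (b i)) := by
  rw [ENNReal.tsum_eq_iSup_sum]
  refine iSup_le fun s => ?_
  refine le_of_tendsto (tendsto_finsetSum s fun i _ => tendsto_enorm_kineticCutoff_sq (A (b i)))
    (Filter.Eventually.of_forall fun n => ?_)
  calc ∑ i ∈ s, ‖kineticCutoff n (A (b i))‖ₑ ^ 2 ≤ hsNormSq b (kineticCutoff n * A) :=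
        ENNReal.sum_le_tsum (f := fun i => ‖(kineticCutoff n * A) (b i)‖ₑ ^ 2) s
    _ ≤ hsNormSq b (kineticCutoff n * B) := hsNormSq_mul_le b h _
    _ ≤ ∑' i, kineticForm (B (b i)) :=
        ENNReal.tsum_le_tsum fun i => enorm_kineticCutoff_sq_le n _

theorem tsum_kineticForm_le_kineticTrace {ι : Type*} (b : HilbertBasis ι ℂ L2) {A T : Op}
    (hT : 0 ≤ T) (h : A * star A ≤ T) : ∑' i, kineticForm (A (b i)) ≤ kineticTrace T := by
  refine (tsum_kineticForm_le b (B := sqrtOp T) ?_).trans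
    (tsum_le_formTrace b fun f => kineticForm (sqrtOp T f))
  rwa [star_sqrtOp, sqrtOp_mul_self hT]

theorem IsKernel.translation_mul {A : Op} {k : R3 × R3 → ℂ} (hk : IsKernel A k) (a : R3) :
    IsKernel (translation a * A) fun z => k (z - (a, 0)) := by
  have hmp : MeasurePreserving (fun z : R3 × R3 => z - (a, 0)) volume volume := by
    rw [Measure.volume_eq_prod]
    exact measurePreserving_sub_right _ _
  refine ⟨hk.1.comp_measurePreserving hmp, fun f => ?_⟩
  filter_upwards [translation_apply_ae a (A f),
    (measurePreserving_sub_right volume a).quasiMeasurePreserving.ae (hk.2 f)] with x h1 h2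
  rw [mul_apply_eq_comp, h1, h2]
  simp

theorem IsKernel.sum_lintegral_translation_sub_le (b : HilbertBasis ℕ ℂ L2) {A : Op}
    {k : R3 × R3 → ℂ} (hk : IsKernel A k) (h : ℝ) :
    ∑ j : Fin 3, ∫⁻ z, ‖k (z - (EuclideanSpace.single j h, 0)) - k z‖ₑ ^ 2 ≤
      ENNReal.ofReal (h ^ 2) * ∑' i, kineticForm (A (b i)) := by
  have e : ∀ j : Fin 3, ∫⁻ z, ‖k (z - (EuclideanSpace.single j h, 0)) - k z‖ₑ ^ 2 =
      ∑' i, ‖translation (EuclideanSpace.single j h) (A (b i)) - A (b i)‖ₑ ^ 2 := fun j => by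
    have := lintegral_kernel_sq b ((hk.translation_mul (EuclideanSpace.single j h)).sub hk)
    simpa only [Pi.sub_apply, hsNormSq, sub_apply, mul_apply_eq_comp] using this
  simp_rw [e]
  rw [← Summable.tsum_finsetSum fun _ _ => ENNReal.summable, ← ENNReal.tsum_mul_left]
  exact ENNReal.tsum_le_tsum fun i => sum_enorm_translation_sub_sq_le h _

end Fourier

/-! ### The Coulomb potential is controlled by the kinetic energy -/

section CoulombKinetic

/-- The components `x_j / |x|` of the radial unit vector field, with value `0` at the origin. -/
def radial (j : Fin 3) (x : R3) : ℝ := x j / ‖x‖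

theorem measurable_radial (j : Fin 3) : Measurable (radial j) := by
  unfold radial
  fun_prop

theorem sum_radial_sq_le (x : R3) : ∑ j, radial j x ^ 2 ≤ 1 := by
  simp only [radial, div_pow]
  rw [← Finset.sum_div]
  refine div_le_one_of_le₀ (le_of_eq ?_) (sq_nonneg _)
  rw [EuclideanSpace.norm_sq_eq]
  simp

theorem abs_radial_le (j : Fin 3) (x : R3) : |radial j x| ≤ 1 := by
  rw [← sq_le_one_iff_abs_le_one]
  exact (Finset.single_le_sum (f := fun j => radial j x ^ 2) (fun i _ => sq_nonneg _)
    (Finset.mem_univ j)).trans (sum_radial_sq_le x)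

theorem norm_add_single_sq (j : Fin 3) (x : R3) (h : ℝ) :
    ‖x + EuclideanSpace.single j h‖ ^ 2 = ‖x‖ ^ 2 + 2 * h * x j + h ^ 2 := by
  rw [norm_add_sq_real, EuclideanSpace.inner_single_right, PiLp.norm_single,
    Real.norm_eq_abs, sq_abs]
  simp
  ring

theorem div_sqrt_mono {a b c : ℝ} (hc : 0 ≤ c) (hab : a ≤ b) :
    a / Real.sqrt (a ^ 2 + c) ≤ b / Real.sqrt (b ^ 2 + c) := by
  have key : ∀ {u v : ℝ}, 0 ≤ u → u ≤ v →
      u / Real.sqrt (u ^ 2 + c) ≤ v / Real.sqrt (v ^ 2 + c) := by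
    intro u v hu huv
    rcases hu.eq_or_lt with rfl | hu'
    · rw [zero_div]
      positivity
    have hv : 0 < v := hu'.trans_le huv
    rw [div_le_div_iff₀ (by positivity) (by positivity)]
    refine le_of_sq_le_sq ?_ (by positivity)
    rw [mul_pow, mul_pow, Real.sq_sqrt (by positivity), Real.sq_sqrt (by positivity)]
    have : u ^ 2 ≤ v ^ 2 := by gcongr
    nlinarith
  rcases le_total 0 a with ha | ha
  · exact key ha hab
  rcases le_total 0 b with hb | hb
  · exact (div_nonpos_of_nonpos_of_nonneg ha (Real.sqrt_nonneg _)).trans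
      (div_nonneg hb (Real.sqrt_nonneg _))
  · have := key (neg_nonneg.2 hb) (neg_le_neg hab)
    rw [neg_sq, neg_sq, neg_div, neg_div] at this
    exact neg_le_neg_iff.1 this

/-- Each component of the radial field increases in its own direction. -/
theorem radial_mono (j : Fin 3) (x : R3) {h : ℝ} (hh : 0 ≤ h) :
    radial j x ≤ radial j (x + EuclideanSpace.single j h) := by
  have hc : 0 ≤ ‖x‖ ^ 2 - x j ^ 2 := by
    have := PiLp.norm_apply_le x j
    rw [sub_nonneg, ← sq_abs (x j)]
    gcongr
    exact this
  have h1 : ‖x‖ = Real.sqrt (x j ^ 2 + (‖x‖ ^ 2 - x j ^ 2)) := by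
    rw [add_sub_cancel, Real.sqrt_sq (norm_nonneg _)]
  have h2 : ‖x + EuclideanSpace.single j h‖ =
      Real.sqrt ((x j + h) ^ 2 + (‖x‖ ^ 2 - x j ^ 2)) := by
    rw [← Real.sqrt_sq (norm_nonneg (x + _)), norm_add_single_sq]
    congr 1
    ring
  have := div_sqrt_mono hc (show x j ≤ x j + h by linarith)
  rw [← h1, ← h2] at this
  simpa [radial] using this

/-- The divergence of the radial field is `2 / |x|`. -/
theorem tendsto_sum_radial {x : R3} (hx : x ≠ 0) :
    Filter.Tendsto (fun h : ℝ => ∑ j, (radial j (x + EuclideanSpace.single j h) - radial j x) / h)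
      (nhdsWithin 0 (Set.Ioi 0)) (nhds (2 / ‖x‖)) := by
  have hn : 0 < ‖x‖ := norm_pos_iff.2 hx
  have hd : ∀ j, HasDerivAt (fun h : ℝ => radial j (x + EuclideanSpace.single j h))
      (1 / ‖x‖ - x j ^ 2 / ‖x‖ ^ 3) 0 := by
    intro j
    have e : (fun h : ℝ => radial j (x + EuclideanSpace.single j h)) =
        fun h => (x j + h) / Real.sqrt (‖x‖ ^ 2 + 2 * h * x j + h ^ 2) := by
      funext h
      rw [← norm_add_single_sq, Real.sqrt_sq (norm_nonneg _)]
      simp [radial]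
    rw [e]
    have h1 : HasDerivAt (fun h : ℝ => x j + h) 1 0 := (hasDerivAt_id 0).const_add _
    have h2 : HasDerivAt (fun h : ℝ => ‖x‖ ^ 2 + 2 * h * x j + h ^ 2) (2 * x j) 0 := by
      have := ((((hasDerivAt_id' (0 : ℝ)).const_mul 2).mul_const (x j)).const_add (‖x‖ ^ 2)).fun_add
        ((hasDerivAt_id' (0 : ℝ)).fun_pow 2)
      refine this.congr_deriv ?_
      simp
    have hsq : Real.sqrt (‖x‖ ^ 2 + 2 * 0 * x j + 0 ^ 2) = ‖x‖ := by
      simp [Real.sqrt_sq hn.le]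
    refine (h1.fun_div (h2.sqrt (by simp [hn.ne'])) (by rw [hsq]; exact hn.ne')).congr_deriv ?_
    rw [hsq]
    field_simp
    ring
  have hsum : 2 / ‖x‖ = ∑ j, (1 / ‖x‖ - x j ^ 2 / ‖x‖ ^ 3) := by
    have : ‖x‖ ^ 2 = ∑ j, x j ^ 2 := by
      rw [EuclideanSpace.norm_sq_eq]
      simp
    rw [Finset.sum_sub_distrib, ← Finset.sum_div (f := fun j => x j ^ 2), ← this]
    simp only [Finset.sum_const, Finset.card_univ, Fintype.card_fin, nsmul_eq_mul]
    field_simp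
    norm_num
  rw [hsum]
  refine tendsto_finsetSum _ fun j _ => ?_
  have := (hd j).tendsto_slope_zero_right
  have h0 : x + EuclideanSpace.single j (0 : ℝ) = x := by
    ext i
    simp
  simpa [div_eq_inv_mul, h0] using this

variable {k : R3 × R3 → ℂ}

theorem integrable_norm_sq (hk : MemLp k 2 volume) : Integrable (fun z => ‖k z‖ ^ 2) volume :=
  hk.norm.integrable_sq

theorem memLp_comp_sub (hk : MemLp k 2 volume) (a : R3) :
    MemLp (fun z => k (z - (a, 0))) 2 volume := by
  refine hk.comp_measurePreserving ?_
  rw [Measure.volume_eq_prod]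
  exact measurePreserving_sub_right _ _

theorem integrable_radial_mul {f : R3 × R3 → ℝ} (hf : Integrable f volume) (j : Fin 3) (a : R3) :
    Integrable (fun z : R3 × R3 => radial j (z.1 - z.2 + a) * f z) volume := by
  have hm : Measurable fun z : R3 × R3 => radial j (z.1 - z.2 + a) :=
    (measurable_radial j).comp (by fun_prop)
  exact hf.bdd_mul hm.aestronglyMeasurable (Filter.Eventually.of_forall fun z => abs_radial_le j _)

/-- The integrated form, over one step `h`, of `∫ (div v) |k|² = -∫ v · ∇|k|²` for the radial field
`v` in the variable `x - y`. -/
theorem integral_radial_sub (hk : MemLp k 2 volume) (j : Fin 3) (h : ℝ) :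
    ∫ z : R3 × R3, (radial j (z.1 - z.2 + EuclideanSpace.single j h) - radial j (z.1 - z.2)) *
        ‖k z‖ ^ 2 =
      ∫ z : R3 × R3, radial j (z.1 - z.2) *
        (‖k (z - (EuclideanSpace.single j h, 0))‖ ^ 2 - ‖k z‖ ^ 2) := by
  set a : R3 := EuclideanSpace.single j h
  have i1 := integrable_radial_mul (integrable_norm_sq hk) j a
  have i2 := integrable_radial_mul (integrable_norm_sq hk) j 0
  have i3 := integrable_radial_mul (integrable_norm_sq (memLp_comp_sub hk a)) j 0
  simp only [add_zero] at i2 i3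
  simp_rw [sub_mul, mul_sub]
  rw [integral_sub i1 i2, integral_sub i3 i2]
  congr 1
  have := integral_add_right_eq_self (μ := (volume : Measure R3).prod (volume : Measure R3))
    (fun z : R3 × R3 => radial j (z.1 - z.2) * ‖k (z - (a, 0))‖ ^ 2) (a, 0)
  rw [← Measure.volume_eq_prod] at this
  rw [← this]
  refine integral_congr_ae (Filter.Eventually.of_forall fun z => ?_)
  simp only [Prod.fst_add, Prod.snd_add, add_zero, add_sub_cancel_right]
  rw [add_sub_right_comm]

/-- The pointwise estimate behind `2 |v · ∇k| |k| ≤ μ⁻¹ |∇k|² + μ |k|²`, for increments: `b` and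
`c j` are the values of `|k|` at a point and at its translates, and `a j` bounds their differences. -/
theorem radial_mul_sub_le {b : ℝ} {a c : Fin 3 → ℝ} (x : R3) (hb : 0 ≤ b)
    (hc : ∀ j, 0 ≤ c j) (h : ∀ j, |c j - b| ≤ a j) {μ : ℝ} (hμ : 0 < μ) :
    ∑ j, radial j x * (c j ^ 2 - b ^ 2) ≤ (1 + 1 / μ) * ∑ j, a j ^ 2 + μ * b ^ 2 := by
  have h1 : ∀ j, radial j x * (c j ^ 2 - b ^ 2) ≤
      (1 + 1 / μ) * a j ^ 2 + μ * b ^ 2 * radial j x ^ 2 := by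
    intro j
    have ha : 0 ≤ a j := (abs_nonneg _).trans (h j)
    have hr := abs_radial_le j x
    have e1 : radial j x * (c j ^ 2 - b ^ 2) ≤ |radial j x| * (a j * (2 * b + a j)) := by
      refine (le_abs_self _).trans ?_
      rw [abs_mul, show c j ^ 2 - b ^ 2 = (c j - b) * (c j + b) by ring, abs_mul]
      have : |c j + b| ≤ 2 * b + a j := by
        rw [abs_of_nonneg (add_nonneg (hc j) hb)]
        have := (abs_le.1 (h j)).2
        linarith
      gcongr
      exact h j
    have e2 : |radial j x| * (a j * a j) ≤ a j ^ 2 := by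
      rw [sq]
      exact mul_le_of_le_one_left (by positivity) hr
    have e3 : |radial j x| * (a j * (2 * b)) ≤ 1 / μ * a j ^ 2 + μ * b ^ 2 * radial j x ^ 2 := by
      rw [← sq_abs (radial j x)]
      have := sq_nonneg (a j - μ * b * |radial j x|)
      have h4 : 0 ≤ 1 / μ * (a j - μ * b * |radial j x|) ^ 2 := by positivity
      have h5 : 1 / μ * (a j - μ * b * |radial j x|) ^ 2 =
          1 / μ * a j ^ 2 + μ * b ^ 2 * |radial j x| ^ 2 - |radial j x| * (a j * (2 * b)) := by
        field_simp
        ring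
      linarith
    calc _ ≤ _ := e1
      _ = |radial j x| * (a j * a j) + |radial j x| * (a j * (2 * b)) := by ring
      _ ≤ _ := by linarith
  calc _ ≤ ∑ j, ((1 + 1 / μ) * a j ^ 2 + μ * b ^ 2 * radial j x ^ 2) :=
        Finset.sum_le_sum fun j _ => h1 j
    _ = (1 + 1 / μ) * ∑ j, a j ^ 2 + μ * b ^ 2 * ∑ j, radial j x ^ 2 := by
        rw [Finset.sum_add_distrib, Finset.mul_sum, Finset.mul_sum]
    _ ≤ (1 + 1 / μ) * ∑ j, a j ^ 2 + μ * b ^ 2 * 1 := by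
        gcongr
        exact sum_radial_sq_le x
    _ = _ := by ring

/-- The Coulomb bound with difference quotients of step `h` in place of derivatives: the left hand
side approximates `2 ∬ |k|² / |x - y|`. The parameter of `radial_mul_sub_le` is `μ = h l`. -/
theorem lintegral_radial_le (hk : MemLp k 2 volume) {h l : ℝ} (hh : 0 < h) (hl : 0 < l) :
    ∫⁻ z : R3 × R3, ENNReal.ofReal (∑ j, (radial j (z.1 - z.2 + EuclideanSpace.single j h) -
        radial j (z.1 - z.2)) / h) * ‖k z‖ₑ ^ 2 ≤
      ENNReal.ofReal (h⁻¹ * (1 + 1 / (h * l))) *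
        (∑ j, ∫⁻ z, ‖k (z - (EuclideanSpace.single j h, 0)) - k z‖ₑ ^ 2) +
      ENNReal.ofReal l * ∫⁻ z, ‖k z‖ₑ ^ 2 := by
  have hofReal : ∀ {f : R3 × R3 → ℂ}, MemLp f 2 volume →
      ENNReal.ofReal (∫ z, ‖f z‖ ^ 2) = ∫⁻ z, ‖f z‖ₑ ^ 2 := fun hf => by
    rw [ofReal_integral_eq_lintegral_ofReal (integrable_norm_sq hf)
      (Filter.Eventually.of_forall fun _ => sq_nonneg _)]
    exact lintegral_congr fun z => by rw [ENNReal.ofReal_pow (norm_nonneg _), ofReal_norm]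
  set e : Fin 3 → R3 := fun j => EuclideanSpace.single j h
  set D : Fin 3 → R3 × R3 → ℝ := fun j z => radial j (z.1 - z.2 + e j) - radial j (z.1 - z.2)
    with hD
  have hD0 : ∀ j z, 0 ≤ D j z := fun j z => sub_nonneg.2 (radial_mono j _ hh.le)
  have iD : ∀ j, Integrable (fun z => D j z * ‖k z‖ ^ 2) volume := fun j => by
    have i1 := integrable_radial_mul (integrable_norm_sq hk) j (e j)
    have i2 := integrable_radial_mul (integrable_norm_sq hk) j 0
    simp only [add_zero] at i2
    refine (i1.sub i2).congr (Filter.Eventually.of_forall fun z => ?_)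
    simp only [hD, Pi.sub_apply]
    ring
  have hd : ∀ j, MemLp (fun z => k (z - (e j, 0)) - k z) 2 volume := fun j =>
    (memLp_comp_sub hk (e j)).sub hk
  have iR : ∀ j, Integrable (fun z : R3 × R3 => radial j (z.1 - z.2) *
      (‖k (z - (e j, 0))‖ ^ 2 - ‖k z‖ ^ 2)) volume := fun j => by
    have := integrable_radial_mul
      ((integrable_norm_sq (memLp_comp_sub hk (e j))).sub (integrable_norm_sq hk)) j 0
    simpa only [add_zero, Pi.sub_apply] using this
  have hsumint : Integrable (fun z => ∑ j, ‖k (z - (e j, 0)) - k z‖ ^ 2) volume :=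
    integrable_finsetSum _ fun j _ => integrable_norm_sq (hd j)
  have hμ : 0 < h * l := by positivity
  have main : ∑ j, ∫ z, D j z * ‖k z‖ ^ 2 ≤
      (1 + 1 / (h * l)) * (∑ j, ∫ z, ‖k (z - (e j, 0)) - k z‖ ^ 2) +
        h * l * ∫ z, ‖k z‖ ^ 2 := by
    have hI : ∀ j, ∫ z, D j z * ‖k z‖ ^ 2 = ∫ z : R3 × R3, radial j (z.1 - z.2) *
        (‖k (z - (e j, 0))‖ ^ 2 - ‖k z‖ ^ 2) := fun j => integral_radial_sub hk j h
    have hJ : ∑ j, ∫ z, ‖k (z - (e j, 0)) - k z‖ ^ 2 =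
        ∫ z, ∑ j, ‖k (z - (e j, 0)) - k z‖ ^ 2 :=
      (integral_finsetSum _ fun j _ => integrable_norm_sq (hd j)).symm
    simp_rw [hI]
    rw [← integral_finsetSum _ fun j _ => iR j, hJ, ← integral_const_mul,
      ← integral_const_mul, ← integral_add (hsumint.const_mul _)
        ((integrable_norm_sq hk).const_mul _)]
    refine integral_mono (integrable_finsetSum _ fun j _ => iR j)
      ((hsumint.const_mul _).add ((integrable_norm_sq hk).const_mul _)) fun z => ?_
    exact radial_mul_sub_le _ (norm_nonneg _) (fun _ => norm_nonneg _)
      (fun j => abs_norm_sub_norm_le _ _) hμ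
  have hlhs : ∫⁻ z : R3 × R3, ENNReal.ofReal (∑ j, D j z / h) * ‖k z‖ₑ ^ 2 =
      ENNReal.ofReal (h⁻¹ * ∑ j, ∫ z, D j z * ‖k z‖ ^ 2) := by
    rw [← integral_finsetSum _ fun j _ => iD j, ← integral_const_mul,
      ofReal_integral_eq_lintegral_ofReal ((integrable_finsetSum _ fun j _ => iD j).const_mul _)
      (Filter.Eventually.of_forall fun z => mul_nonneg (by positivity)
        (Finset.sum_nonneg fun j _ => mul_nonneg (hD0 j z) (sq_nonneg _)))]
    refine lintegral_congr fun z => ?_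
    rw [← ofReal_norm, ← ENNReal.ofReal_pow (norm_nonneg _), ← ENNReal.ofReal_mul
      (Finset.sum_nonneg fun j _ => div_nonneg (hD0 j z) hh.le), ← Finset.sum_div,
      ← Finset.sum_mul]
    congr 1
    ring
  rw [hlhs]
  refine (ENNReal.ofReal_le_ofReal (mul_le_mul_of_nonneg_left main (by positivity))).trans_eq ?_
  rw [← hofReal hk]
  have hdiff : ∑ j, ∫⁻ z, ‖k (z - (e j, 0)) - k z‖ₑ ^ 2 =
      ∑ j, ENNReal.ofReal (∫ z, ‖k (z - (e j, 0)) - k z‖ ^ 2) :=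
    Finset.sum_congr rfl fun j _ => (hofReal (hd j)).symm
  rw [hdiff]
  rw [← ENNReal.ofReal_sum_of_nonneg fun j _ => integral_nonneg fun _ => sq_nonneg _,
    ← ENNReal.ofReal_mul (by positivity), ← ENNReal.ofReal_mul hl.le, ← ENNReal.ofReal_add]
  · congr 1
    field_simp
  · exact mul_nonneg (by positivity)
      (Finset.sum_nonneg fun j _ => integral_nonneg fun _ => sq_nonneg _)
  · exact mul_nonneg hl.le (integral_nonneg fun _ => sq_nonneg _)

/-- `2 ∬ |k|² / |x - y| ≤ l⁻¹ ‖∇ A‖² + l ‖A‖²` in Hilbert–Schmidt norms: the limit `h → 0` of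
`lintegral_radial_le`, with Fatou's lemma on the left hand side. -/
theorem IsKernel.coulomb_le (b : HilbertBasis ℕ ℂ L2) {A : Op} (hk : IsKernel A k) {l : ℝ}
    (hl : 0 < l) :
    2 * ∫⁻ z : R3 × R3, ‖k z‖ₑ ^ 2 / ‖z.1 - z.2‖ₑ ≤
      ENNReal.ofReal l⁻¹ * ∑' i, kineticForm (A (b i)) + ENNReal.ofReal l * hsNormSq b A := by
  set Q := ∑' i, kineticForm (A (b i)) with hQ
  rcases eq_or_ne Q ⊤ with hQt | hQt
  · rw [hQt, ENNReal.mul_top (by simpa using hl), top_add]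
    exact le_top
  set s : ℕ → ℝ := fun n => 1 / ((n : ℝ) + 1) with hs
  have hs0 : ∀ n, 0 < s n := fun n => by positivity
  have hslim : Filter.Tendsto s Filter.atTop (nhds 0) := tendsto_one_div_add_atTop_nhds_zero_nat
  have hslim' : Filter.Tendsto s Filter.atTop (nhdsWithin 0 (Set.Ioi 0)) :=
    tendsto_nhdsWithin_iff.2 ⟨hslim, Filter.Eventually.of_forall hs0⟩
  set G : ℕ → R3 × R3 → ℝ≥0∞ := fun n z =>
    ENNReal.ofReal (∑ j, (radial j (z.1 - z.2 + EuclideanSpace.single j (s n)) -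
      radial j (z.1 - z.2)) / s n) * ‖k z‖ₑ ^ 2 with hG
  have hGm : ∀ n, AEMeasurable (G n) volume := fun n => by
    have hm : Measurable fun z : R3 × R3 =>
        ∑ j, (radial j (z.1 - z.2 + EuclideanSpace.single j (s n)) -
          radial j (z.1 - z.2)) / s n := by
      refine Finset.measurable_sum _ fun j _ => ?_
      have h1 : Measurable fun z : R3 × R3 =>
          radial j (z.1 - z.2 + EuclideanSpace.single j (s n)) :=
        (measurable_radial j).comp (by fun_prop)
      have h2 : Measurable fun z : R3 × R3 => radial j (z.1 - z.2) :=
        (measurable_radial j).comp (by fun_prop)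
      exact (h1.sub h2).div_const _
    exact hm.ennreal_ofReal.aemeasurable.mul (hk.1.1.enorm.pow_const 2)
  have hlim : ∀ᵐ z : R3 × R3, 2 * (‖k z‖ₑ ^ 2 / ‖z.1 - z.2‖ₑ) =
      Filter.liminf (fun n => G n z) Filter.atTop := by
    filter_upwards [ae_fst_ne_snd] with z hz
    have hz' : z.1 - z.2 ≠ 0 := sub_ne_zero.2 hz
    have h1 := ENNReal.tendsto_ofReal ((tendsto_sum_radial hz').comp hslim')
    have h2 := ENNReal.Tendsto.mul_const (b := ‖k z‖ₑ ^ 2) h1 (Or.inr (by simp))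
    refine Eq.trans ?_ h2.liminf_eq.symm
    rw [ENNReal.ofReal_div_of_pos (norm_pos_iff.2 hz'), ofReal_norm, ENNReal.ofReal_ofNat]
    simp only [div_eq_mul_inv]
    ring
  have hbound : ∀ n, ∫⁻ z, G n z ≤
      ENNReal.ofReal (s n + l⁻¹) * Q + ENNReal.ofReal l * hsNormSq b A := fun n => by
    refine (lintegral_radial_le hk.1 (hs0 n) hl).trans ?_
    rw [lintegral_kernel_sq b hk]
    refine add_le_add ?_ le_rfl
    refine (mul_le_mul_of_nonneg_left
      (hk.sum_lintegral_translation_sub_le b (s n)) zero_le).trans_eq ?_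
    rw [← mul_assoc, ← ENNReal.ofReal_mul (by have := hs0 n; positivity)]
    congr 2
    have := (hs0 n).ne'
    field_simp
  have htend : Filter.Tendsto
      (fun n => ENNReal.ofReal (s n + l⁻¹) * Q + ENNReal.ofReal l * hsNormSq b A) Filter.atTop
      (nhds (ENNReal.ofReal l⁻¹ * Q + ENNReal.ofReal l * hsNormSq b A)) := by
    refine Filter.Tendsto.add ?_ tendsto_const_nhds
    refine ENNReal.Tendsto.mul_const (ENNReal.tendsto_ofReal ?_) (Or.inr hQt)
    simpa using hslim.add_const l⁻¹
  calc 2 * ∫⁻ z : R3 × R3, ‖k z‖ₑ ^ 2 / ‖z.1 - z.2‖ₑ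
      = ∫⁻ z : R3 × R3, 2 * (‖k z‖ₑ ^ 2 / ‖z.1 - z.2‖ₑ) :=
        (lintegral_const_mul' _ _ (by simp)).symm
    _ = ∫⁻ z, Filter.liminf (fun n => G n z) Filter.atTop := lintegral_congr_ae hlim
    _ ≤ Filter.liminf (fun n => ∫⁻ z, G n z) Filter.atTop := lintegral_liminf_le' hGm
    _ ≤ Filter.liminf (fun n => ENNReal.ofReal (s n + l⁻¹) * Q +
          ENNReal.ofReal l * hsNormSq b A) Filter.atTop :=
        Filter.liminf_le_liminf (Filter.Eventually.of_forall hbound)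
    _ = _ := htend.liminf_eq

/-- Optimization over `l`, with `l = (Q / N)^{1/2}` when both `Q` and `N` are finite and nonzero. If
`N = 0` and `Q = ∞`, then the hypothesis `h` is void and the bound is `∞ * 0 = 0`; hence `hI`. -/
theorem le_sqrt_mul_sqrt {I Q N : ℝ≥0∞} (hN : N ≠ ⊤) (hI : N = 0 → I = 0)
    (h : ∀ l : ℝ, 0 < l → 2 * I ≤ ENNReal.ofReal l⁻¹ * Q + ENNReal.ofReal l * N) :
    I ≤ Q ^ (1 / 2 : ℝ) * N ^ (1 / 2 : ℝ) := by
  rcases eq_or_ne N 0 with hN0 | hN0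
  · rw [hI hN0]
    exact zero_le
  rcases eq_or_ne Q ⊤ with hQ | hQ
  · rw [hQ, ENNReal.top_rpow_of_pos (by norm_num), ENNReal.top_mul]
    · exact le_top
    · simp [hN0, hN]
  obtain ⟨q, hq⟩ : ∃ q : ℝ, q = Q.toReal := ⟨_, rfl⟩
  obtain ⟨n, hn⟩ : ∃ n : ℝ, n = N.toReal := ⟨_, rfl⟩
  have hq0 : 0 ≤ q := hq ▸ ENNReal.toReal_nonneg
  have hn0 : 0 < n := hn ▸ ENNReal.toReal_pos hN0 hN
  have hQq : Q = ENNReal.ofReal q := by rw [hq, ENNReal.ofReal_toReal hQ]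
  have hNn : N = ENNReal.ofReal n := by rw [hn, ENNReal.ofReal_toReal hN]
  have h' : ∀ l : ℝ, 0 < l → 2 * I ≤ ENNReal.ofReal (l⁻¹ * q + l * n) := fun l hl => by
    rw [ENNReal.ofReal_add (by positivity) (by positivity), ENNReal.ofReal_mul (by positivity),
      ENNReal.ofReal_mul hl.le, ← hQq, ← hNn]
    exact h l hl
  rw [hQq, hNn, ENNReal.ofReal_rpow_of_nonneg hq0 (by norm_num),
    ENNReal.ofReal_rpow_of_nonneg hn0.le (by norm_num), ← Real.sqrt_eq_rpow, ← Real.sqrt_eq_rpow,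
    ← ENNReal.ofReal_mul (Real.sqrt_nonneg _)]
  have h2 : 2 * I ≤ 2 * ENNReal.ofReal (Real.sqrt q * Real.sqrt n) := by
    rw [← ENNReal.ofReal_ofNat 2, ← ENNReal.ofReal_mul (by norm_num), ENNReal.ofReal_ofNat]
    rcases hq0.eq_or_lt with hq0' | hq0'
    · have hlim : Filter.Tendsto (fun l : ℝ => ENNReal.ofReal (l⁻¹ * q + l * n))
          (nhdsWithin 0 (Set.Ioi 0)) (nhds (ENNReal.ofReal (0 * n))) := by
        refine ENNReal.tendsto_ofReal ?_
        simp only [← hq0', mul_zero, zero_add]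
        exact ((continuous_id.mul continuous_const).tendsto (0 : ℝ)).mono_left nhdsWithin_le_nhds
      have := ge_of_tendsto hlim (eventually_mem_nhdsWithin.mono fun l hl => h' l hl)
      simpa [← hq0'] using this
    · have hsq : 0 < Real.sqrt q := Real.sqrt_pos.2 hq0'
      have hsn : 0 < Real.sqrt n := Real.sqrt_pos.2 hn0
      refine (h' (Real.sqrt q / Real.sqrt n) (by positivity)).trans_eq ?_
      congr 1
      have e1 := Real.mul_self_sqrt hq0
      have e2 := Real.mul_self_sqrt hn0.le
      field_simp
      nlinarith
  exact (ENNReal.mul_le_mul_iff_right (by norm_num) (by norm_num)).1 h2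

end CoulombKinetic

end

end DensityMatrix

theorem lemma2p4 (γ : Op) (hγ : IsDensityMatrix γ)
    (χ : R3 → ℝ) (hχ : ContDiff ℝ (⊤ : ℕ∞) χ) (hχ0 : ∀ x, 0 ≤ χ x) (hχ1 : ∀ x, χ x ≤ 1)
    (p : ℝ) (hp : p ∈ Set.Icc (1 / 2 : ℝ) 1) :
    (HasKernel (mulOp χ * power γ p * mulOp χ) ∧
      HasKernel (power (mulOp χ * γ * mulOp χ) p) ∧
      HasKernel (mulOp χ * power γ p)) ∧
    exchange (mulOp χ * power γ p * mulOp χ) ≤ exchange (power (mulOp χ * γ * mulOp χ) p) ∧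
    exchange (mulOp χ * power γ p) ≤
      kineticTrace (mulOp χ * γ * mulOp χ) ^ (1 / 2 : ℝ) *
        (∫⁻ x, ENNReal.ofReal (χ x ^ 2) * density γ x) ^ (1 / 2 : ℝ) := by
  have hc := hχ.continuous
  obtain ⟨b, -⟩ := hγ.exists_isSpectralDecomposition
  have hM := star_mulOp hc hχ0 hχ1
  have hM1 := mulOp_mul_self_le_one hc hχ0 hχ1
  have hM' : IsSelfAdjoint (mulOp χ) := hM
  have hγ0 := hγ.nonneg
  set M := mulOp χ
  set B := M * sqrtOp γ with hB
  have hBB : B * star B = M * γ * M := by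
    rw [hB, star_mul, hM, star_sqrtOp, mul_assoc M, ← mul_assoc (sqrtOp γ), sqrtOp_mul_self hγ0,
      mul_assoc]
  have hT0 : 0 ≤ M * γ * M := hM'.conjugate_nonneg hγ0
  have hT1 : M * γ * M ≤ 1 := by
    have := hM'.conjugate_le_conjugate hγ.le_one
    rw [mul_one] at this
    exact this.trans hM1
  have hBfin : hsNormSq b B < ⊤ := by
    rw [← hsNormSq_star b b, hB, star_mul, hM, star_sqrtOp]
    refine lt_of_le_of_lt (hsNormSq_mul_le b (B := 1) ?_ _) ?_
    · rw [hM, star_one, one_mul]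
      exact hM1
    · rw [mul_one]
      exact hγ.hsNormSq_sqrtOp_lt_top b
  have hpp := power_mul_power_le hγ0 hγ.le_one hp.1
  have hA : (M * power γ p) * star (M * power γ p) ≤ M * γ * M := by
    rw [star_mul, star_power, hM, mul_assoc M, ← mul_assoc (power γ p), ← mul_assoc M]
    exact hM'.conjugate_le_conjugate hpp
  have hAM : (M * power γ p * M) * star (M * power γ p * M) ≤ M * γ * M := by
    have h1 := hM'.conjugate_le_conjugate
      ((show IsSelfAdjoint (power γ p) from star_power γ p).conjugate_le_conjugate hM1)
    refine le_trans (le_of_eq ?_) (h1.trans ?_)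
    · simp only [star_mul, star_power, hM, mul_assoc]
    · rw [mul_one]
      exact hM'.conjugate_le_conjugate hpp
  have hP : power (M * γ * M) p * star (power (M * γ * M) p) ≤ M * γ * M := by
    rw [star_power]
    exact power_mul_power_le hT0 hT1 hp.1
  have hfin : ∀ {C : Op}, C * star C ≤ M * γ * M → hsNormSq b C < ⊤ := fun hC =>
    (hsNormSq_le b (hBB ▸ hC)).trans_lt hBfin
  have hk1 : HasKernel (M * power γ p * M) := hasKernel_of_hsNormSq b (hfin hAM)
  have hk2 : HasKernel (power (M * γ * M) p) := hasKernel_of_hsNormSq b (hfin hP)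
  have hk3 : HasKernel (M * power γ p) := hasKernel_of_hsNormSq b (hfin hA)
  refine ⟨⟨hk1, hk2, hk3⟩, ?_, ?_⟩
  · exact exchange_mono b hk1 hk2 (hM'.conjugate_nonneg (power_nonneg γ p))
      (mul_power_mul_le hγ0 hM' hM1 (by linarith [hp.1]) hp.2)
  · rw [hγ.lintegral_density hc hχ0 hχ1 b]
    obtain ⟨k, hk⟩ := hk3
    have hI : ∫⁻ z : R3 × R3, ‖k z‖ₑ ^ 2 / ‖z.1 - z.2‖ₑ ≤
        kineticTrace (M * γ * M) ^ (1 / 2 : ℝ) * hsNormSq b B ^ (1 / 2 : ℝ) := by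
      refine le_sqrt_mul_sqrt hBfin.ne (fun h0 => ?_) fun l hl => (hk.coulomb_le b hl).trans ?_
      · have hN : hsNormSq b (M * power γ p) = 0 :=
          le_antisymm ((hsNormSq_le b (hBB ▸ hA)).trans_eq h0) zero_le
        rw [← lintegral_kernel_sq b hk,
          lintegral_eq_zero_iff' (hk.1.1.enorm.pow_const 2)] at hN
        rw [lintegral_congr_ae (g := fun _ => 0), lintegral_zero]
        filter_upwards [hN] with z hz
        rw [hz]
        simp
      · gcongr
        · exact tsum_kineticForm_le_kineticTrace b hT0 hA
        · exact hsNormSq_le b (hBB ▸ hA)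
    rw [hk.exchange_eq b]
    refine le_trans ?_ hI
    exact mul_le_of_le_one_left zero_le (by simp)
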